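/- Let $\mathbb F$ be an algebraically closed field of characteristic zero, $k\ge 1$, $n=2k+2$, $\lambda\in(\mathbb F^\times)^k$, and let $H_n^\lambda$ be the twisted Heisenberg algebra: the Lie algebra with basis $z,u,e_1,\hat e_1,\dots,e_k,\hat e_k$ whose only nonzero brackets of basis vectors are $[e_i,\hat e_i]=\lambda_i z$, $[u,e_i]=\lambda_i\hat e_i$, $[u,\hat e_i]=\lambda_i e_i$ (and their negatives in the reverse order). Let $l$ be odd and $\beta_1,\dots,\beta_s\in\mathbb F^\times$. A block of type I, $B_l^{\mathrm I}(u,\alpha)$, is a linearly independent family $x_1,y_1,\dots,x_l,y_l$ with $[u,x_i]=\alpha x_{i+1}$ and $[u,y_i]=\alpha y_{i+1}$ for $i<l$, $[u,x_l]=\alpha x_1$, $[u,y_l]=(-1)^l\alpha y_1$, $[x_i,y_{l-i}]=(-1)^{l-i}\alpha z$ for $i<l$, $[x_l,y_l]=(-1)^l\alpha z$, all other brackets of its elements being $0$. Let $\Gamma=\Gamma(l,s,0;\beta_1,\dots,\beta_s)$ be a (fine) group grading on $H_n^\lambda$ whose homogeneous components are the lines spanned by the vectors of a basis $\{z,u\}\cup\bigcup_{j=1}^s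 B_l^{\mathrm I}(u,\beta_j)$ of $H_n^\lambda$ ($z$ central, $u\in H_n^\lambda$), elements of different blocks having bracket $0$. Let $\mathcal W(\Gamma)=\mathrm{Aut}(\Gamma)/\mathrm{Stab}(\Gamma)$ be its Weyl group: $\mathrm{Aut}(\Gamma)$ consists of the automorphisms of $H_n^\lambda$ permuting the homogeneous components, $\mathrm{Stab}(\Gamma)$ of those leaving each component invariant. For $\alpha\in\mathbb F^\times$ let $\widetilde\alpha$ be its class modulo the $2l$-th roots of unity. Let $\widetilde\delta_1,\dots,\widetilde\delta_{s'}$ be the different classes among $\widetilde\beta_1,\dots,\widetilde\beta_s$ and $m_1,\dots,m_{s'}\geq 1$ their multiplicities. Then $m_1+\dots+m_{s'}=s=\frac{n-2}{2l}$. There is a greatest positive integer $p$ such that, for a primitive $p$-th root of unity $\varepsilon$, there is a family (multiset) $Y$ of classes with $$\{\widetilde\beta_1,\dots,\widetilde\beta_s\}=\bigcup_{t=0}^{p-1}\varepsilon^tY ,$$ where for every $j$ the intersection $Y\cap\varepsilon^jY$ is either $\emptyset$ or $Y$. Here the left side is a multiset, multiplicities in the union and the intersection are maxima and minima, and so the union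 is the disjoint union of the \emph{different} ones among the $\varepsilon^tY$. For this $p$ and any primitive $p$-th root of unity $\varepsilon$, let $q$ be the least positive integer with $\widetilde\varepsilon^{\,q}=\widetilde 1$; it does not depend on $\varepsilon$ and divides $p$. Then $$\mathcal W(\Gamma)\;\cong\;\frac{\big((S_{m_1}\times\dots\times S_{m_{s'}}\times\mathbb Z_2)\ltimes\mathbb Z_l^s\big)\rtimes\mathbb Z_p}{\mathbb Z_{p/q}} .$$ Here $S_{m_1}\times\dots\times S_{m_{s'}}$ acts on $\mathbb Z_l^s$ by permuting the coordinates belonging to the same class, and the generator of $\mathbb Z_2$ acts as $-1$. For every such $\varepsilon$ the action of a generator $\gamma$ of $\mathbb Z_p$ can be chosen to be induced by a permutation $\pi$ of the $s$ blocks carrying each block of class $\widetilde\delta$ to one of class $\varepsilon\widetilde\delta$: it sends the $j$-th generator of $\mathbb Z_l^s$ to the $\pi(j)$-th one or to its inverse, conjugates the permutations by $\pi$, and fixes $\mathbb Z_2$. The subgroup $\mathbb Z_{p/q}$ is normal and generated by $\gamma^q w^{-1}$ for some $w$ in $(S_{m_1}\times\dots\times S_{m_{s'}}\times\mathbb Z_2)\ltimes\mathbb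 Z_l^s$. -/

import Mathlib

/-! ### Twisted Heisenberg algebras -/

/-- The underlying space of the twisted Heisenberg algebra `H_n^λ`, `n = 2k + 2`, in coordinates
with respect to the basis `{z, u, e₁, ê₁, …, e_k, ê_k}`. -/
@[ext]
structure TwistedHeisenberg {F : Type*} [Field F] {k : ℕ} (lam : Fin k → Fˣ) where
  /-- the coefficient of `z` -/
  z : F
  /-- the coefficient of `u` -/
  u : F
  /-- the coefficients of the `e_i` -/
  e : Fin k → F
  /-- the coefficients of the `ê_i` -/
  e' : Fin k → F

namespace TwistedHeisenberg

variable {F : Type*} [Field F] {k : ℕ} {lam : Fin k → Fˣ}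

/-- Coordinates. -/
def toProd : TwistedHeisenberg lam ≃ F × F × (Fin k → F) × (Fin k → F) where
  toFun a := (a.z, a.u, a.e, a.e')
  invFun p := ⟨p.1, p.2.1, p.2.2.1, p.2.2.2⟩
  left_inv _ := rfl
  right_inv _ := rfl

instance : AddCommGroup (TwistedHeisenberg lam) := (toProd (lam := lam)).addCommGroup

instance : Module F (TwistedHeisenberg lam) := (toProd (lam := lam)).module F

theorem add_def (a b : TwistedHeisenberg lam) :
    a + b = ⟨a.z + b.z, a.u + b.u, a.e + b.e, a.e' + b.e'⟩ := rfl

theorem smul_def (c : F) (a : TwistedHeisenberg lam) :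
    c • a = ⟨c * a.z, c * a.u, c • a.e, c • a.e'⟩ := rfl

theorem zero_def : (0 : TwistedHeisenberg lam) = ⟨0, 0, 0, 0⟩ := rfl

/-- The bracket given by `[e_i, ê_i] = λ_i z`, `[u, e_i] = λ_i ê_i`, `[u, ê_i] = λ_i e_i`, all other
brackets of basis vectors being zero. -/
instance : Bracket (TwistedHeisenberg lam) (TwistedHeisenberg lam) where
  bracket a b :=
    { z := ∑ i, (lam i : F) * (a.e i * b.e' i - a.e' i * b.e i)
      u := 0
      e := fun i => (lam i : F) * (a.u * b.e' i - b.u * a.e' i)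
      e' := fun i => (lam i : F) * (a.u * b.e i - b.u * a.e i) }

theorem bracket_def (a b : TwistedHeisenberg lam) :
    ⁅a, b⁆ = ⟨∑ i, (lam i : F) * (a.e i * b.e' i - a.e' i * b.e i), 0,
      fun i => (lam i : F) * (a.u * b.e' i - b.u * a.e' i),
      fun i => (lam i : F) * (a.u * b.e i - b.u * a.e i)⟩ := rfl

instance : LieRing (TwistedHeisenberg lam) where
  add_lie x y w := by
    simp only [bracket_def, add_def, Pi.add_apply]
    ext i
    · simp only [← Finset.sum_add_distrib]
      exact Finset.sum_congr rfl fun i _ => by ring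
    · simp
    · simp only [Pi.add_apply]; ring
    · simp only [Pi.add_apply]; ring
  lie_add x y w := by
    simp only [bracket_def, add_def, Pi.add_apply]
    ext i
    · simp only [← Finset.sum_add_distrib]
      exact Finset.sum_congr rfl fun i _ => by ring
    · simp
    · simp only [Pi.add_apply]; ring
    · simp only [Pi.add_apply]; ring
  lie_self x := by
    simp only [bracket_def, zero_def]
    ext i
    · have h : ∀ i, (lam i : F) * (x.e i * x.e' i - x.e' i * x.e i) = 0 := fun i => by
        rw [mul_comm (x.e' i), sub_self, mul_zero]
      simp only [h, Finset.sum_const_zero]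
    · rfl
    · simp
    · simp
  leibniz_lie x y w := by
    simp only [bracket_def, add_def]
    ext i
    · simp only [← Finset.sum_add_distrib]
      exact Finset.sum_congr rfl fun i _ => by ring
    · simp
    · simp only [Pi.add_apply]; ring
    · simp only [Pi.add_apply]; ring

instance : LieAlgebra F (TwistedHeisenberg lam) where
  lie_smul c x y := by
    simp only [bracket_def, smul_def]
    ext i
    · simp only [Finset.mul_sum, Pi.smul_apply, smul_eq_mul]
      exact Finset.sum_congr rfl fun i _ => by ring
    · simp
    · simp only [Pi.smul_apply, smul_eq_mul]; ring
    · simp only [Pi.smul_apply, smul_eq_mul]; ring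

end TwistedHeisenberg

/-! ### The Weyl group of a grading -/

section WeylGroup

variable {F L G : Type*} [Field F] [LieRing L] [LieAlgebra F L]

/-- The group of automorphisms of the Lie algebra `L`. -/
def lieAut (F L : Type*) [Field F] [LieRing L] [LieAlgebra F L] : Subgroup (L ≃ₗ[F] L) where
  carrier := {f | ∀ x y : L, f ⁅x, y⁆ = ⁅f x, f y⁆}
  mul_mem' := by
    intro f g hf hg x y
    rw [LinearEquiv.mul_apply, hg, hf]
    rfl
  one_mem' := fun _ _ => rfl
  inv_mem' := by
    intro f hf x y
    apply f.injective
    rw [hf]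
    have h : ∀ a : L, f (f⁻¹ a) = a := fun a => f.apply_symm_apply a
    rw [h, h, h]

/-- The set of the (nonzero) homogeneous components of a grading. -/
def homogeneousComponents (𝒜 : G → Submodule F L) : Set (Submodule F L) :=
  {U | U ≠ ⊥ ∧ ∃ g, 𝒜 g = U}

/-- `Aut(Γ)`: the automorphisms of the algebra that permute the homogeneous components. -/
def gradingAut (𝒜 : G → Submodule F L) : Subgroup (lieAut F L) where
  carrier := {f | ∀ U : Submodule F L,
    U.map (f : L ≃ₗ[F] L).toLinearMap ∈ homogeneousComponents 𝒜 ↔ U ∈ homogeneousComponents 𝒜}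
  mul_mem' := by
    intro f g hf hg U
    have h : U.map ((f * g : lieAut F L) : L ≃ₗ[F] L).toLinearMap
        = (U.map (g : L ≃ₗ[F] L).toLinearMap).map (f : L ≃ₗ[F] L).toLinearMap := by
      rw [← Submodule.map_comp]; rfl
    rw [h, hf, hg]
  one_mem' := by
    intro U
    have h : U.map ((1 : lieAut F L) : L ≃ₗ[F] L).toLinearMap = U := Submodule.map_id U
    rw [h]
  inv_mem' := by
    intro f hf U
    rw [← hf]
    have h : (U.map ((f⁻¹ : lieAut F L) : L ≃ₗ[F] L).toLinearMap).map
        (f : L ≃ₗ[F] L).toLinearMap = U := by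
      rw [← Submodule.map_comp]
      have h2 : (f : L ≃ₗ[F] L).toLinearMap ∘ₗ ((f⁻¹ : lieAut F L) : L ≃ₗ[F] L).toLinearMap
          = LinearMap.id := by
        ext x
        exact (f : L ≃ₗ[F] L).apply_symm_apply x
      rw [h2, Submodule.map_id]
    rw [h]

/-- `Stab(Γ)`: the automorphisms of the algebra that leave every component invariant. -/
def gradingStab (𝒜 : G → Submodule F L) : Subgroup (gradingAut 𝒜) where
  carrier := {f | ∀ g, (𝒜 g).map (f : L ≃ₗ[F] L).toLinearMap = 𝒜 g}
  mul_mem' := by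
    intro f g hf hg a
    have h : (𝒜 a).map ((f * g : gradingAut 𝒜) : L ≃ₗ[F] L).toLinearMap
        = ((𝒜 a).map (g : L ≃ₗ[F] L).toLinearMap).map (f : L ≃ₗ[F] L).toLinearMap := by
      rw [← Submodule.map_comp]; rfl
    rw [h, hg, hf]
  one_mem' := fun a => Submodule.map_id (𝒜 a)
  inv_mem' := by
    intro f hf a
    conv_lhs => rw [← hf a]
    rw [← Submodule.map_comp]
    have h2 : ((f⁻¹ : gradingAut 𝒜) : L ≃ₗ[F] L).toLinearMap ∘ₗ (f : L ≃ₗ[F] L).toLinearMap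
        = LinearMap.id := by
      ext x
      exact (f : L ≃ₗ[F] L).symm_apply_apply x
    rw [h2, Submodule.map_id]

instance (𝒜 : G → Submodule F L) : (gradingStab 𝒜).Normal where
  conj_mem := by
    intro n hn f a
    have h : (𝒜 a).map ((f * n * f⁻¹ : gradingAut 𝒜) : L ≃ₗ[F] L).toLinearMap
        = (((𝒜 a).map ((f⁻¹ : gradingAut 𝒜) : L ≃ₗ[F] L).toLinearMap).map
            (n : L ≃ₗ[F] L).toLinearMap).map (f : L ≃ₗ[F] L).toLinearMap := by
      rw [← Submodule.map_comp, ← Submodule.map_comp]; rfl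
    rw [h]
    have hinv : ∀ U : Submodule F L, (U.map ((f⁻¹ : gradingAut 𝒜) : L ≃ₗ[F] L).toLinearMap).map
        (f : L ≃ₗ[F] L).toLinearMap = U := by
      intro U
      rw [← Submodule.map_comp]
      have h2 : (f : L ≃ₗ[F] L).toLinearMap ∘ₗ ((f⁻¹ : gradingAut 𝒜) : L ≃ₗ[F] L).toLinearMap
          = LinearMap.id := by
        ext x
        exact (f : L ≃ₗ[F] L).apply_symm_apply x
      rw [h2, Submodule.map_id]
    by_cases h0 : 𝒜 a = ⊥
    · rw [h0]; simp
    · obtain ⟨-, b, hb⟩ := ((f⁻¹).2 (𝒜 a)).2 ⟨h0, a, rfl⟩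
      have hb' : (𝒜 a).map ((f⁻¹ : gradingAut 𝒜) : L ≃ₗ[F] L).toLinearMap = 𝒜 b := hb.symm
      rw [hb', hn b, ← hb', hinv]

/-- The Weyl group `W(Γ) = Aut(Γ)/Stab(Γ)`. -/
abbrev WeylGroup (𝒜 : G → Submodule F L) : Type _ := gradingAut 𝒜 ⧸ gradingStab 𝒜

end WeylGroup

/-! ### The gradings `Γ(l, s, 0; β₁, …, β_s)` -/

/-- Labels of the basis `{z, u} ∪ ⋃_j B_l^I(u, β_j)`. The label `x j i` (`y j i`), `i : Fin l`, is
that of the element `x_{i+1}` (`y_{i+1}`) of the `j`-th block. -/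
inductive BlockLabel (s l : ℕ) : Type
  | z : BlockLabel s l
  | u : BlockLabel s l
  | x (j : Fin s) (i : Fin l) : BlockLabel s l
  | y (j : Fin s) (i : Fin l) : BlockLabel s l

/-- The products in a block `B_l^I(u, α) = {x₁, y₁, …, x_l, y_l}` of type I. The entries of the
families `x`, `y` at `i : Fin l` are `x_{i+1}`, `y_{i+1}`; `finRotate l` is the cyclic successor. -/
structure IsBlockI {F L : Type*} [Field F] [LieRing L] [LieAlgebra F L] (z u : L) {l : ℕ} (α : Fˣ)
    (x y : Fin l → L) : Prop where
  linearIndependent : LinearIndependent F (Sum.elim x y)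
  /-- `[u, x_i] = α x_{i+1}` for `i < l` and `[u, x_l] = α x₁` -/
  u_x : ∀ i, ⁅u, x i⁆ = (α : F) • x (finRotate l i)
  /-- `[u, y_i] = α y_{i+1}` for `i < l` and `[u, y_l] = (-1)^l α y₁` -/
  u_y : ∀ i, ⁅u, y i⁆ = ((if (i : ℕ) + 1 = l then (-1) ^ l else 1) * (α : F)) • y (finRotate l i)
  /-- `[x_i, y_{l-i}] = (-1)^{l-i} α z` for `i < l`, `[x_l, y_l] = (-1)^l α z`, and the other
  `[x_i, y_j]` vanish -/
  x_y : ∀ i j : Fin l, ⁅x i, y j⁆ =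
    (if ((i : ℕ) + 1) + ((j : ℕ) + 1) = l ∨ ((i : ℕ) + 1) + ((j : ℕ) + 1) = 2 * l
      then (-1) ^ ((j : ℕ) + 1) * (α : F) else 0) • z
  x_x : ∀ i j, ⁅x i, x j⁆ = 0
  y_y : ∀ i j, ⁅y i, y j⁆ = 0

/-- The grading with components `𝒜 g` is a grading `Γ(l, s, 0; β₁, …, β_s)`: its homogeneous
components are the lines spanned by the vectors of a basis `{z, u} ∪ ⋃_j B_l^I(u, β_j)`, with `z`
central and with brackets of elements of different blocks equal to zero. In particular all
components are one-dimensional, so that the grading is fine. -/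
def IsGammaGrading {F L G : Type*} [Field F] [LieRing L] [LieAlgebra F L]
    (𝒜 : G → Submodule F L) (l s : ℕ) (β : Fin s → Fˣ) : Prop :=
  ∃ b : Module.Basis (BlockLabel s l) F L,
    (∀ a : L, ⁅b .z, a⁆ = 0) ∧
    (∀ j, IsBlockI (b .z) (b .u) (β j) (fun i => b (.x j i)) (fun i => b (.y j i))) ∧
    (∀ j j', j ≠ j' → ∀ i i', ⁅b (.x j i), b (.x j' i')⁆ = 0 ∧ ⁅b (.x j i), b (.y j' i')⁆ = 0 ∧
      ⁅b (.y j i), b (.y j' i')⁆ = 0) ∧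
    homogeneousComponents 𝒜 = Set.range (fun c => Submodule.span F {b c})

/-! ### Classes of scalars -/

/-- The class `α̃ = {α ζ^t : 0 ≤ t < 2l}`, `ζ` a primitive `2l`-th root of unity. -/
def tildeClass {F : Type*} [Field F] (l : ℕ) : Fˣ →* Fˣ ⧸ rootsOfUnity (2 * l) F :=
  QuotientGroup.mk' (rootsOfUnity (2 * l) F)

open scoped Classical in
/-- The multiset `M` is the union of the translates `c^t Y`, `t = 0, …, p - 1`, any two different
ones of which are disjoint. -/
def IsSplitting {C : Type*} [CommGroup C] (M : Multiset C) (c : C) (p : ℕ) (Y : Multiset C) :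
    Prop :=
  M = (Finset.range p).sup (fun t => Y.map (fun a => c ^ t * a)) ∧
  ∀ j : ℕ, Y ∩ Y.map (fun a => c ^ j * a) = 0 ∨ Y ∩ Y.map (fun a => c ^ j * a) = Y

/-- The positive integers `p` such that, for a primitive `p`-th root of unity `ε`, there is a
splitting `{β̃₁, …, β̃_s} = ⋃_{t < p} ε^t Y`. -/
def splittingOrders {F : Type*} [Field F] (l : ℕ) {s : ℕ} (β : Fin s → Fˣ) : Set ℕ :=
  {p | 0 < p ∧ ∃ ε : Fˣ, IsPrimitiveRoot ε p ∧ ∃ Y : Multiset (Fˣ ⧸ rootsOfUnity (2 * l) F),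
    IsSplitting (Finset.univ.val.map fun j => tildeClass l (β j)) (tildeClass l ε) p Y}

/-! ### The group `(S_{m₁} × ⋯ × S_{m_{s'}} × ℤ₂) ⋉ ℤ_l^s` -/

/-- The action of `S_{m₁} × ⋯ × S_{m_{s'}} × ℤ₂` on `ℤ_l^s`, the `s = m₁ + ⋯ + m_{s'}` coordinates
being indexed by the pairs `⟨i, t⟩`, `t < m_i`: permutations permute the coordinates, and the
generator of `ℤ₂ = {1, -1}` acts as `-1`. -/
def permSignAction (l : ℕ) {s' : ℕ} (m : Fin s' → ℕ) :
    ((∀ i, Equiv.Perm (Fin (m i))) × ℤˣ) →* MulAut (Multiplicative ((Σ i, Fin (m i)) → ZMod l)) where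
  toFun h := AddEquiv.toMultiplicative
    { toFun := fun a j => (h.2 : ℤ) • a ((Equiv.Perm.sigmaCongrRightHom _ h.1)⁻¹ j)
      invFun := fun a j => ((h.2⁻¹ : ℤˣ) : ℤ) • a (Equiv.Perm.sigmaCongrRightHom _ h.1 j)
      left_inv := by
        intro a; funext j
        beta_reduce
        rw [smul_smul, ← Units.val_mul, inv_mul_cancel]
        simp
      right_inv := by
        intro a; funext j
        beta_reduce
        rw [smul_smul, ← Units.val_mul, mul_inv_cancel]
        simp
      map_add' := by
        intro a a'; funext j
        simp only [Pi.add_apply, smul_add] }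
  map_one' := by
    ext a j
    simp
  map_mul' := by
    intro h h'
    ext a j
    simp [mul_smul]

/-- The group `(S_{m₁} × ⋯ × S_{m_{s'}} × ℤ₂) ⋉ ℤ_l^s`. -/
abbrev BlockWeylGroup (l : ℕ) {s' : ℕ} (m : Fin s' → ℕ) : Type :=
  Multiplicative ((Σ i, Fin (m i)) → ZMod l) ⋊[permSignAction l m]
    ((∀ i, Equiv.Perm (Fin (m i))) × ℤˣ)

/-- The automorphism `φ` of `(S_{m₁} × ⋯ × S_{m_{s'}} × ℤ₂) ⋉ ℤ_l^s` is induced by the permutation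
`π` of the `s` blocks, with signs `τ`: it sends the `j`-th generator `θ_j` of `ℤ_l^s` to
`θ_{π j}^{±1}`, conjugates the permutations by `π`, and fixes the `ℤ₂`-component. -/
def IsInducedByBlockPerm {l s' : ℕ} {m : Fin s' → ℕ} (φ : MulAut (BlockWeylGroup l m))
    (π : Equiv.Perm (Σ i, Fin (m i))) (τ : (Σ i, Fin (m i)) → ℤˣ) : Prop :=
  ∀ g : BlockWeylGroup l m,
    (∀ j, Multiplicative.toAdd (φ g).left (π j) = (τ j : ℤ) • Multiplicative.toAdd g.left j) ∧
    Equiv.Perm.sigmaCongrRightHom _ (φ g).right.1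
      = π * Equiv.Perm.sigmaCongrRightHom _ g.right.1 * π⁻¹ ∧
    (φ g).right.2 = g.right.2

/-!
The vectors `x_i` and `y_i` of each block form two cycles of length `l` under `ad u`, on which
`(ad u) ^ l` acts by `β_j ^ l` and, as `l` is odd, by `-β_j ^ l`. An automorphism permuting the
homogeneous lines preserves the lines of `z` (the center) and of `u` (the only one not contained in
the derived algebra), so it permutes the remaining lines. This permutation respects the steps along
the cycles and the pairing of the lines with nonzero bracket, and, if `u` is multiplied by `α`, it
multiplies the *charges* `±β_j ^ l` by `α ^ (-l)`. Conversely every such permutation is induced by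
an automorphism, because the coefficients can be adjusted along the cycles
(`exists_zmod_coboundary`). After a renormalization of the basis that replaces `β_j` by the
representative `δ_i` of its class (`exists_isCycleBasis`), the Weyl group is therefore the
permutation group `CycleLabel.autGroup` (`IsCycleBasis.nonempty_weylGroup_mulEquiv`).

The permutations multiplying the charges by `±1` form the normal subgroup
`(S_{m₁} × ⋯ × S_{m_{s'}} × ℤ₂) ⋉ ℤ_l^s` (`BlockWeylGroup.mem_range_toAutGroup_iff`). Any
permutation in the group multiplies them by `α ^ l` for some `α` whose class preserves the multiset
of the classes. Such `α` form a finite subgroup of `Fˣ` containing the `2l`-th roots of unity, so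
they are the `p`-th roots of unity for some `p = 2lq`
(`exists_mem_multisetStabilizer_tildeClass_iff`), and `p` is the greatest splitting order, because a
splitting with respect to `ε` exists if and only if the class of `ε` preserves the multiset
(`exists_isSplitting_iff`). A primitive `p`-th root of unity lifts to a permutation `γ` whose `q`-th
power is the generator of `ℤ₂`, so that `γ ^ p = 1` (`exists_autGroup_lift`). The presentation of
the Weyl group then follows from a general fact on extensions of cyclic groups
(`exists_semidirectProduct_quotient_equiv`).
-/

/-! ### Extensions of a cyclic group by a normal subgroup -/

/-- Let `H` be embedded by `ι` as a normal subgroup of `W`, let `W` be generated by `H` and an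
element `g` with `g ^ p = 1`, and let `q` divide every exponent `t` with `g ^ t ∈ H`. If `g ^ q`
is the image of `w ∈ H`, then `W` is the quotient of `H ⋊ ℤ_p`, the generator `γ` of `ℤ_p` acting
as conjugation by `g`, by the cyclic group generated by `γ ^ q w⁻¹`. -/
theorem exists_semidirectProduct_quotient_equiv {H W : Type*} [Group H] [Group W] (ι : H →* W)
    (hι : Function.Injective ι) [ι.range.Normal] (g : W) {p q : ℕ} [NeZero p] (hqp : q ∣ p)
    (w : H) (hw : ι w = g ^ q) (hgp : g ^ p = 1)
    (hgen : ∀ x, ∃ (h : H) (t : ℕ), x = ι h * g ^ t)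
    (hmin : ∀ t : ℕ, g ^ t ∈ ι.range → q ∣ t) :
    ∃ φ : Multiplicative (ZMod p) →* MulAut H,
      (∀ h, ι (φ (Multiplicative.ofAdd 1) h) = g * ι h * g⁻¹) ∧
      ∃ (K : Subgroup (H ⋊[φ] Multiplicative (ZMod p))) (_ : K.Normal),
        K = Subgroup.zpowers
          (SemidirectProduct.inr (Multiplicative.ofAdd 1) ^ q * (SemidirectProduct.inl w)⁻¹) ∧
        Nonempty (K ≃* Multiplicative (ZMod (p / q))) ∧
        Nonempty (W ≃* (H ⋊[φ] Multiplicative (ZMod p)) ⧸ K) := by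
  have hzp : ∃ f : Multiplicative (ZMod p) →* W, ∀ t : ℕ,
      f (Multiplicative.ofAdd (t : ZMod p)) = g ^ t := by
    refine ⟨AddMonoidHom.toMultiplicativeLeft
      (ZMod.lift p ⟨zmultiplesHom (Additive W) (Additive.ofMul g), ?_⟩), fun t => ?_⟩
    · simp only [zmultiplesHom_apply, natCast_zsmul]
      rw [← ofMul_pow, hgp, ofMul_one]
    · have h := ZMod.lift_coe p (⟨zmultiplesHom (Additive W) (Additive.ofMul g), by
        simp only [zmultiplesHom_apply, natCast_zsmul]
        rw [← ofMul_pow, hgp, ofMul_one]⟩ : {f : ℤ →+ Additive W // f p = 0}) (t : ℤ)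
      rw [Int.cast_natCast] at h
      simp [h]
  obtain ⟨f, hf⟩ := hzp
  have hf1 : f (Multiplicative.ofAdd 1) = g := by simpa using hf 1
  let e : H ≃* ι.range := MonoidHom.ofInjective hι
  let Θ : W →* MulAut H := (MulAut.congr e.symm).toMonoidHom.comp MulAut.conjNormal
  have hΘ : ∀ x h, ι (Θ x h) = x * ι h * x⁻¹ := by
    intro x h
    have h1 : ((e (Θ x h) : ι.range) : W) = x * (e h : W) * x⁻¹ := by
      simp [Θ, MulAut.congr]
    exact h1
  let φ : Multiplicative (ZMod p) →* MulAut H := Θ.comp f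
  let Ψ : H ⋊[φ] Multiplicative (ZMod p) →* W := SemidirectProduct.lift ι f (by
    intro t
    ext h
    simp [φ, hΘ])
  have hΨ : ∀ x, Ψ x = ι x.left * f x.right := fun x => rfl
  have hsurj : Function.Surjective Ψ := by
    intro x
    obtain ⟨h, t, rfl⟩ := hgen x
    exact ⟨⟨h, Multiplicative.ofAdd (t : ZMod p)⟩, by rw [hΨ, hf]⟩
  set κ : H ⋊[φ] Multiplicative (ZMod p) :=
    SemidirectProduct.inr (Multiplicative.ofAdd 1) ^ q * (SemidirectProduct.inl w)⁻¹ with hκ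
  have hκker : κ ∈ Ψ.ker := by
    rw [MonoidHom.mem_ker, hκ, map_mul, map_pow, map_inv]
    simp [Ψ, hf1, hw]
  have hκr : SemidirectProduct.rightHom κ = Multiplicative.ofAdd ((q : ℕ) : ZMod p) := by
    rw [hκ, map_mul, map_pow, map_inv, SemidirectProduct.rightHom_inl,
      SemidirectProduct.rightHom_inr, inv_one, mul_one, ← ofAdd_nsmul, nsmul_one]
  -- `Ψ` restricted to `H` is injective, so its kernel embeds into `ℤ_p`.
  have hinj : ∀ x ∈ Ψ.ker, SemidirectProduct.rightHom x = 1 → x = 1 := by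
    intro x hx hr
    have hr' : x.right = 1 := hr
    rw [MonoidHom.mem_ker, hΨ, hr', map_one, mul_one] at hx
    exact SemidirectProduct.ext (hι (by rw [hx]; exact (map_one ι).symm)) hr'
  have hK : Ψ.ker = Subgroup.zpowers κ := by
    apply le_antisymm
    · intro x hx
      obtain ⟨t, ht⟩ := ZMod.natCast_zmod_surjective (Multiplicative.toAdd x.right)
      have ht' : x.right = Multiplicative.ofAdd (t : ZMod p) := by rw [ht]; rfl
      have hx' := hx
      rw [MonoidHom.mem_ker, hΨ, ht', hf] at hx'
      obtain ⟨a, rfl⟩ := hmin t ⟨x.left⁻¹, by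
        rw [map_inv]; exact (eq_inv_of_mul_eq_one_right hx').symm⟩
      have h1 : x * (κ ^ a)⁻¹ = 1 := by
        apply hinj _ (Ψ.ker.mul_mem hx (Ψ.ker.inv_mem (Ψ.ker.pow_mem hκker a)))
        rw [map_mul, map_inv, map_pow, hκr]
        have h2 : SemidirectProduct.rightHom x = x.right := rfl
        rw [h2, ht', ← ofAdd_nsmul, mul_inv_eq_one]
        congr 1
        rw [nsmul_eq_mul]; push_cast; ring
      rw [mul_inv_eq_one] at h1
      exact ⟨a, by rw [h1]; exact zpow_natCast κ a⟩
    · rw [Subgroup.zpowers_le]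
      exact hκker
  have hord : orderOf κ = p / q := by
    have h1 : orderOf κ = orderOf (SemidirectProduct.rightHom κ) := by
      refine orderOf_eq_orderOf_iff.mpr fun n => ?_
      constructor
      · intro h; rw [← map_pow, h, map_one]
      · intro h
        exact hinj _ (Ψ.ker.pow_mem hκker n) (by rw [map_pow, h])
    rw [h1, hκr, orderOf_ofAdd_eq_addOrderOf, ZMod.addOrderOf_coe _ (NeZero.ne p),
      Nat.gcd_eq_right hqp]
  refine ⟨φ, fun h => by simp only [φ, MonoidHom.comp_apply]; rw [hΘ, hf1], Ψ.ker, inferInstance,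
    hK, ?_, ⟨(QuotientGroup.quotientKerEquivOfSurjective Ψ hsurj).symm⟩⟩
  rw [hK]
  refine ⟨(zmodCyclicMulEquiv (G := Subgroup.zpowers κ) inferInstance).symm.trans ?_⟩
  rw [Nat.card_zpowers, hord]

/-! ### Splittings of multisets and their stabilizers -/

/-- The translations of a group `C` that preserve the multiset `M`. -/
def multisetStabilizer {C : Type*} [CommGroup C] (M : Multiset C) : Subgroup C where
  carrier := {c | M.map (fun a => c * a) = M}
  mul_mem' := by
    intro a b ha hb
    simp only [Set.mem_ofPred_eq] at *
    have h : (M.map (fun x => b * x)).map (fun x => a * x) = M := by rw [hb, ha]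
    rw [Multiset.map_map] at h
    simpa [Function.comp_def, mul_assoc] using h
  one_mem' := by simp
  inv_mem' := by
    intro a ha
    simp only [Set.mem_ofPred_eq] at *
    conv_lhs => rw [← ha]
    rw [Multiset.map_map]
    simp

theorem mem_multisetStabilizer {C : Type*} [CommGroup C] {M : Multiset C} {c : C} :
    c ∈ multisetStabilizer M ↔ M.map (fun a => c * a) = M := Iff.rfl

theorem finite_multisetStabilizer {C : Type*} [CommGroup C] {M : Multiset C} (hM : M ≠ 0) :
    Finite (multisetStabilizer M) := by
  classical
  obtain ⟨a, ha⟩ := Multiset.exists_mem_of_ne_zero hM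
  refine Finite.of_injective (β := M.toFinset) (fun c => ⟨c * a, ?_⟩) ?_
  · rw [Multiset.mem_toFinset]
    have h := mem_multisetStabilizer.mp c.2
    have h2 : (c : C) * a ∈ M.map (fun x => (c : C) * x) := Multiset.mem_map_of_mem _ ha
    rwa [h] at h2
  · intro c c' h
    simp only [Subtype.mk.injEq, mul_left_inj] at h
    exact Subtype.ext h

open scoped Classical in
theorem count_map_mul {C : Type*} [CommGroup C] (Y : Multiset C) (c x : C) :
    (Y.map (fun a => c * a)).count x = Y.count (c⁻¹ * x) := by
  have h := Multiset.count_map_eq_count' (fun a => c * a) Y (mul_right_injective c) (c⁻¹ * x)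
  rwa [mul_inv_cancel_left] at h

open scoped Classical in
theorem count_finset_sup {ι C : Type*} (s : Finset ι) (f : ι → Multiset C) (x : C) :
    (s.sup f).count x = s.sup fun i => (f i).count x := by
  induction s using Finset.induction_on with
  | empty => simp
  | insert a s _ ih => rw [Finset.sup_insert, Finset.sup_insert, ← ih, Multiset.sup_eq_union,
      Multiset.count_union]

/-- A multiset has a splitting with respect to `c` if and only if it is preserved by the
translation by `c`: in the one direction the translation permutes the multisets `c ^ t Y`, in the
other direction `Y` is the part of the multiset on a set of representatives of the cosets of
`⟨c⟩`. -/
theorem exists_isSplitting_iff {C : Type*} [CommGroup C] {M : Multiset C} {c : C} {p : ℕ}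
    (hp : 0 < p) (hc : c ^ p = 1) :
    (∃ Y, IsSplitting M c p Y) ↔ c ∈ multisetStabilizer M := by
  classical
  constructor
  · rintro ⟨Y, hY, -⟩
    have hcount : ∀ x, M.count x = (Finset.range p).sup fun t => Y.count ((c ^ t)⁻¹ * x) := by
      intro x
      conv_lhs => rw [hY]
      have h := count_finset_sup (Finset.range p) (fun t => Y.map (fun a => c ^ t * a)) x
      simp only [count_map_mul] at h
      convert h
    refine Multiset.eq_of_le_of_card_le (Multiset.le_iff_count.mpr fun x => ?_) (by simp)
    have h1 := count_map_mul M c x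
    rw [show Multiset.count x (M.map (fun a => c * a)) = M.count (c⁻¹ * x) by convert h1]
    rw [hcount, hcount]
    refine Finset.sup_le fun t ht => ?_
    rw [Finset.mem_range] at ht
    rcases Nat.lt_or_ge (t + 1) p with h | h
    · refine le_trans (le_of_eq ?_) (Finset.le_sup (Finset.mem_range.mpr h))
      congr 1
      rw [pow_succ]; group
    · have ht' : t + 1 = p := by omega
      refine le_trans (le_of_eq ?_) (Finset.le_sup (Finset.mem_range.mpr hp))
      congr 1
      rw [← mul_assoc, ← mul_inv, ← pow_succ, ht', hc]
      simp
  · intro h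
    have hinv : ∀ (t : ℕ) (x : C), M.count (c ^ t * x) = M.count x := by
      intro t x
      have h1 := mem_multisetStabilizer.mp ((multisetStabilizer M).pow_mem h t)
      have h2 := count_map_mul M (c ^ t) (c ^ t * x)
      rw [h1, inv_mul_cancel_left] at h2
      convert h2
    let rep : C → C := fun a => (QuotientGroup.mk a : C ⧸ Subgroup.zpowers c).out
    have hrep : ∀ a, ∃ t < p, c ^ t * rep a = a := by
      intro a
      have h1 : (QuotientGroup.mk (rep a) : C ⧸ Subgroup.zpowers c) = QuotientGroup.mk a :=
        Quotient.out_eq _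
      rw [QuotientGroup.eq] at h1
      obtain ⟨t, ht⟩ := h1
      refine ⟨(t % p).toNat, ?_, ?_⟩
      · have := Int.emod_lt_of_pos t (by exact_mod_cast hp : (0 : ℤ) < p)
        have := Int.emod_nonneg t (by exact_mod_cast hp.ne' : (p : ℤ) ≠ 0)
        omega
      · have h2 : c ^ (t % p).toNat = c ^ t := by
          rw [← zpow_natCast, Int.toNat_of_nonneg
            (Int.emod_nonneg t (by exact_mod_cast hp.ne' : (p : ℤ) ≠ 0))]
          conv_rhs => rw [← Int.emod_add_mul_ediv t p, zpow_add, zpow_mul, zpow_natCast, hc,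
            one_zpow, mul_one]
        have h3 : c ^ t = (rep a)⁻¹ * a := ht
        rw [h2, h3, mul_comm, mul_inv_cancel_left]
    have hrep' : ∀ (t : ℕ) a, rep (c ^ t * a) = rep a := by
      intro t a
      have h1 : (QuotientGroup.mk (c ^ t * a) : C ⧸ Subgroup.zpowers c) = QuotientGroup.mk a := by
        rw [QuotientGroup.eq]
        refine ⟨-(t : ℤ), ?_⟩
        simp
      change Quotient.out _ = Quotient.out _
      rw [h1]
    have hcY : ∀ x, (M.filter fun a => rep a = a).count x = if rep x = x then M.count x else 0 :=
      fun x => Multiset.count_filter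
    refine ⟨M.filter fun a => rep a = a, ?_, fun j => ?_⟩
    · ext x
      have h1 := count_finset_sup (Finset.range p)
        (fun t => (M.filter fun a => rep a = a).map (fun a => c ^ t * a)) x
      simp only [count_map_mul] at h1
      trans ((Finset.range p).sup fun t =>
        Multiset.count ((c ^ t)⁻¹ * x) (M.filter fun a => rep a = a))
      swap
      · symm; convert h1
      apply le_antisymm
      · obtain ⟨t, ht, htx⟩ := hrep x
        refine le_trans (le_of_eq ?_) (Finset.le_sup (Finset.mem_range.mpr ht))
        conv_rhs => rw [← htx, inv_mul_cancel_left]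
        have h2 : rep (rep x) = rep x := by
          conv_lhs => rw [← hrep' t, htx]
        rw [hcY, if_pos h2, ← hinv t (rep x), htx]
      · refine Finset.sup_le fun t _ => ?_
        rw [hcY, ← hinv t x, ← hinv t ((c ^ t)⁻¹ * x), mul_inv_cancel_left, hinv]
        split_ifs <;> simp
    · by_cases hj : c ^ j = 1
      · right
        simp only [hj, one_mul, Multiset.map_id']
        exact inf_idem _
      · left
        rw [Multiset.eq_zero_iff_forall_notMem]
        intro a ha
        rw [Multiset.mem_inter] at ha
        obtain ⟨ha1, ha2⟩ := ha
        obtain ⟨b, hb, hba⟩ := Multiset.mem_map.mp ha2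
        rw [Multiset.mem_filter] at ha1 hb
        have h1 : a = b := by
          rw [← ha1.2, ← hb.2, ← hba, hrep']
        rw [← h1] at hba
        exact hj (mul_eq_right.mp hba)

theorem tildeClass_eq_iff {F : Type*} [Field F] {l : ℕ} {a b : Fˣ} :
    tildeClass l a = tildeClass l b ↔ a ^ (2 * l) = b ^ (2 * l) := by
  change (QuotientGroup.mk a : Fˣ ⧸ rootsOfUnity (2 * l) F) = QuotientGroup.mk b ↔ _
  rw [QuotientGroup.eq, mem_rootsOfUnity, mul_pow, inv_pow, inv_mul_eq_one]

theorem tildeClass_eq_one_iff {F : Type*} [Field F] {l : ℕ} {a : Fˣ} :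
    tildeClass l a = 1 ↔ a ^ (2 * l) = 1 := by
  rw [← map_one (tildeClass l), tildeClass_eq_iff, one_pow]

theorem exists_isPrimitiveRoot_units (F : Type*) [Field F] [IsAlgClosed F] [CharZero F] {n : ℕ}
    (hn : n ≠ 0) : ∃ ζ : Fˣ, IsPrimitiveRoot ζ n := by
  have : NeZero (n : F) := ⟨by exact_mod_cast hn⟩
  obtain ⟨ζ, hζ⟩ := HasEnoughRootsOfUnity.exists_primitiveRoot F n
  exact ⟨(hζ.isUnit hn).unit, hζ.isUnit_unit hn⟩

/-- The scalars whose classes preserve a nonempty multiset of classes are the `p`-th roots of unity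
for some `p`, since they form a finite subgroup of `Fˣ`. This subgroup contains the `2l`-th roots
of unity. -/
theorem exists_mem_multisetStabilizer_tildeClass_iff {F : Type*} [Field F] [IsAlgClosed F]
    [CharZero F] {l : ℕ} (hl : l ≠ 0) {M : Multiset (Fˣ ⧸ rootsOfUnity (2 * l) F)} (hM : M ≠ 0) :
    ∃ q : ℕ, 0 < q ∧
      ∀ α : Fˣ, tildeClass l α ∈ multisetStabilizer M ↔ α ^ (2 * l * q) = 1 := by
  have := finite_multisetStabilizer hM
  let R : Subgroup Fˣ := (multisetStabilizer M).comap (tildeClass l)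
  have hR : ∀ {α}, α ∈ R ↔ tildeClass l α ∈ multisetStabilizer M := Iff.rfl
  set N := Nat.card (multisetStabilizer M) with hN
  have hN0 : N ≠ 0 := Nat.card_pos.ne'
  have hle : R ≤ rootsOfUnity (N * (2 * l)) F := by
    intro α hα
    have h1 : (⟨tildeClass l α, hR.mp hα⟩ : multisetStabilizer M) ^ N = 1 := pow_card_eq_one'
    have h2 : tildeClass l α ^ N = 1 := congrArg Subtype.val h1
    rw [← map_pow, tildeClass_eq_one_iff, ← pow_mul] at h2
    rwa [mem_rootsOfUnity]
  have : NeZero (N * (2 * l)) := ⟨by positivity⟩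
  have : Finite R := Finite.of_injective _ (Subgroup.inclusion_injective hle)
  set p := Nat.card R with hp
  have hp0 : p ≠ 0 := Nat.card_pos.ne'
  have hmem : ∀ α, α ∈ R ↔ α ^ p = 1 := by
    have hR' : R ≤ rootsOfUnity p F := by
      intro α hα
      have h1 : (⟨α, hα⟩ : R) ^ p = 1 := pow_card_eq_one'
      exact (mem_rootsOfUnity _ _).mpr (congrArg Subtype.val h1)
    have : NeZero p := ⟨hp0⟩
    have h2 : R = rootsOfUnity p F := by
      apply Subgroup.eq_of_le_of_card_ge hR'
      exact card_rootsOfUnity F p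
    intro α
    rw [h2, mem_rootsOfUnity]
  have hdvd : 2 * l ∣ p := by
    obtain ⟨ζ, hζ⟩ := exists_isPrimitiveRoot_units F (n := 2 * l) (by positivity)
    refine hζ.dvd_of_pow_eq_one p ((hmem ζ).mp ?_)
    rw [hR, tildeClass_eq_one_iff.mpr hζ.pow_eq_one]
    exact one_mem _
  obtain ⟨q, hq⟩ := hdvd
  refine ⟨q, Nat.pos_of_ne_zero (by rintro rfl; exact hp0 (by simpa using hq)), fun α => ?_⟩
  rw [← hR, hmem, hq]

/-- The splitting orders are the orders of the roots of unity whose classes preserve the multiset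
of the classes of `β₁, …, β_s`. -/
theorem mem_splittingOrders_iff {F : Type*} [Field F] {l s : ℕ} {β : Fin s → Fˣ} {p : ℕ} :
    p ∈ splittingOrders l β ↔ 0 < p ∧ ∃ ε : Fˣ, IsPrimitiveRoot ε p ∧
      tildeClass l ε ∈ multisetStabilizer (Finset.univ.val.map fun j => tildeClass l (β j)) := by
  unfold splittingOrders
  simp only [Set.mem_ofPred_eq]
  refine and_congr_right fun hp => exists_congr fun ε => and_congr_right fun hε => ?_
  exact exists_isSplitting_iff hp (by rw [← map_pow, hε.pow_eq_one, map_one])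

theorem isGreatest_splittingOrders {F : Type*} [Field F] [IsAlgClosed F] [CharZero F] {l s : ℕ}
    {β : Fin s → Fˣ} {p : ℕ} (hp : 0 < p)
    (h : ∀ α : Fˣ, tildeClass l α ∈
      multisetStabilizer (Finset.univ.val.map fun j => tildeClass l (β j)) ↔ α ^ p = 1) :
    IsGreatest (splittingOrders l β) p := by
  constructor
  · obtain ⟨ζ, hζ⟩ := exists_isPrimitiveRoot_units F hp.ne'
    exact mem_splittingOrders_iff.mpr ⟨hp, ζ, hζ, (h ζ).mpr hζ.pow_eq_one⟩
  · intro p' hp'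
    obtain ⟨-, ε, hε, hεM⟩ := mem_splittingOrders_iff.mp hp'
    exact Nat.le_of_dvd hp (hε.dvd_of_pow_eq_one p ((h ε).mp hεM))

theorem isLeast_tildeClass_pow_eq_one {F : Type*} [Field F] {l q : ℕ} (hl : l ≠ 0) (hq : 0 < q)
    {ε : Fˣ} (hε : IsPrimitiveRoot ε (2 * l * q)) :
    IsLeast {a : ℕ | 0 < a ∧ tildeClass l ε ^ a = tildeClass l 1} q := by
  have h : ∀ a : ℕ, tildeClass l ε ^ a = tildeClass l 1 ↔ q ∣ a := by
    intro a
    rw [← map_pow, map_one, tildeClass_eq_one_iff, ← pow_mul, hε.pow_eq_one_iff_dvd, mul_comm a,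
      Nat.mul_dvd_mul_iff_left (by positivity)]
  constructor
  · exact ⟨hq, (h q).mpr dvd_rfl⟩
  · rintro a ⟨ha, ha'⟩
    exact Nat.le_of_dvd ha ((h a).mp ha')

/-! ### Permutations of oriented cycles -/

/-- The signs `±1` in `Fˣ`. -/
def signUnit (F : Type*) [Field F] : ℤˣ →* Fˣ := Units.map (Int.castRingHom F).toMonoidHom

theorem signUnit_neg {F : Type*} [Field F] (σ : ℤˣ) : signUnit F (-σ) = -signUnit F σ := by
  ext; simp [signUnit]

theorem signUnit_injective {F : Type*} [Field F] [CharZero F] :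
    Function.Injective (signUnit F) := by
  intro a b h
  have h1 : ((a : ℤ) : F) = ((b : ℤ) : F) := congrArg Units.val h
  exact Units.ext (by exact_mod_cast h1)

theorem signUnit_pow_two {F : Type*} [Field F] (σ : ℤˣ) : signUnit F σ ^ 2 = 1 := by
  rw [← map_pow, Int.units_sq, map_one]

theorem signUnit_pow_odd {F : Type*} [Field F] (σ : ℤˣ) {l : ℕ} (hl : Odd l) :
    signUnit F σ ^ l = signUnit F σ := by
  obtain ⟨t, rfl⟩ := hl
  rw [pow_succ, pow_mul, signUnit_pow_two, one_pow, one_mul]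

theorem exists_signUnit_of_sq_eq_one {F : Type*} [Field F] {a : Fˣ} (h : a ^ 2 = 1) :
    ∃ σ : ℤˣ, a = signUnit F σ := by
  have h1 : (a : F) ^ 2 = 1 := congrArg Units.val h
  rcases sq_eq_one_iff.mp h1 with h2 | h2
  · exact ⟨1, by rw [map_one]; exact Units.ext h2⟩
  · exact ⟨-1, by rw [signUnit_neg, map_one]; exact Units.ext h2⟩

theorem units_int_sq_zmod {l : ℕ} (σ : ℤˣ) :
    ((σ : ℤ) : ZMod l) * ((σ : ℤ) : ZMod l) = 1 := by
  rw [← Int.cast_mul, ← Units.val_mul, Int.units_mul_self]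
  simp

/-- The points of the oriented cycles `{(j, σ, a) : a ∈ ℤ_l}`, two opposite ones for each block
`j`. -/
abbrev CycleLabel (J : Type*) (l : ℕ) : Type _ := J × ℤˣ × ZMod l

namespace CycleLabel

variable {J : Type*} {l : ℕ}

/-- The step along the cycles, forwards on those of sign `1` and backwards on those of
sign `-1`. -/
def rotate : Equiv.Perm (CycleLabel J l) where
  toFun x := (x.1, x.2.1, x.2.2 + ((x.2.1 : ℤ) : ZMod l))
  invFun x := (x.1, x.2.1, x.2.2 - ((x.2.1 : ℤ) : ZMod l))
  left_inv x := by simp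
  right_inv x := by simp

/-- The exchange of the two cycles of each block. -/
def swap : Equiv.Perm (CycleLabel J l) where
  toFun x := (x.1, -x.2.1, x.2.2)
  invFun x := (x.1, -x.2.1, x.2.2)
  left_inv x := by simp
  right_inv x := by simp

theorem rotate_apply (j : J) (σ : ℤˣ) (a : ZMod l) :
    rotate (j, σ, a) = (j, σ, a + ((σ : ℤ) : ZMod l)) := rfl

theorem swap_apply (j : J) (σ : ℤˣ) (a : ZMod l) : swap (j, σ, a) = (j, -σ, a) := rfl

/-- The scalar `σ d_j ^ l` attached to the cycles of the block `j`. -/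
def charge {F : Type*} [Field F] (d : J → Fˣ) (x : CycleLabel J l) : Fˣ :=
  signUnit F x.2.1 * d x.1 ^ l

/-- The permutations of the points that respect the steps along the cycles and the pairing of
opposite cycles, and that multiply the charge by a constant. -/
def autGroup {F : Type*} [Field F] (d : J → Fˣ) (l : ℕ) :
    Subgroup (Equiv.Perm (CycleLabel J l)) where
  carrier := {g | (∀ x, g (rotate x) = rotate (g x)) ∧ (∀ x, g (swap x) = swap (g x)) ∧
    ∃ c : Fˣ, ∀ x, charge d (g x) = c * charge d x}
  mul_mem' := by
    rintro g g' ⟨h1, h2, c, h3⟩ ⟨h1', h2', c', h3'⟩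
    exact ⟨fun x => by simp [h1, h1'], fun x => by simp [h2, h2'], c * c', fun x => by
      rw [Equiv.Perm.mul_apply, h3, h3', mul_assoc]⟩
  one_mem' := ⟨fun _ => rfl, fun _ => rfl, 1, fun x => by simp⟩
  inv_mem' := by
    rintro g ⟨h1, h2, c, h3⟩
    refine ⟨fun x => ?_, fun x => ?_, c⁻¹, fun x => ?_⟩
    · rw [Equiv.Perm.inv_eq_iff_eq, h1]; simp
    · rw [Equiv.Perm.inv_eq_iff_eq, h2]; simp
    · have h := h3 (g⁻¹ x)
      rw [Equiv.Perm.coe_inv, g.apply_symm_apply] at h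
      rw [h, Equiv.Perm.coe_inv, inv_mul_cancel_left]

section autGroup

variable {F : Type*} [Field F] {d : J → Fˣ} [NeZero l]

/-- The image of the point `(j, 1, 0)` determines those of all points of the block `j`. -/
theorem autGroup_apply (g : autGroup d l) (j : J) (σ : ℤˣ) (a : ZMod l) :
    (g : Equiv.Perm (CycleLabel J l)) (j, σ, a) =
      ((g.1 (j, 1, 0)).1, (g.1 (j, 1, 0)).2.1 * σ,
        (g.1 (j, 1, 0)).2.2 + (((g.1 (j, 1, 0)).2.1 : ℤ) : ZMod l) * a) := by
  obtain ⟨g, h1, h2, -⟩ := g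
  have hpos : ∀ n : ℕ, g (j, 1, (n : ZMod l)) = ((g (j, 1, 0)).1, (g (j, 1, 0)).2.1,
      (g (j, 1, 0)).2.2 + (((g (j, 1, 0)).2.1 : ℤ) : ZMod l) * n) := by
    intro n
    induction n with
    | zero => simp
    | succ n ih =>
      have h := h1 (j, 1, (n : ZMod l))
      rw [rotate_apply, ih, rotate_apply] at h
      push_cast at h ⊢
      rw [h]
      ext
      · rfl
      · rfl
      · simp only; ring
  obtain ⟨n, rfl⟩ := ZMod.natCast_zmod_surjective a
  rcases Int.units_eq_one_or σ with rfl | rfl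
  · rw [hpos, mul_one]
  · have h := h2 (j, 1, (n : ZMod l))
    rw [swap_apply, hpos, swap_apply] at h
    rw [h, mul_neg_one]

/-- The permutation of the blocks underlying a permutation of the points. -/
def blockPerm (g : autGroup d l) : Equiv.Perm J where
  toFun j := (g.1 (j, 1, 0)).1
  invFun j := (g.1⁻¹ (j, 1, 0)).1
  left_inv j := by
    have h := congrArg Prod.fst (autGroup_apply g⁻¹ (g.1 (j, 1, 0)).1 (g.1 (j, 1, 0)).2.1
      (g.1 (j, 1, 0)).2.2)
    simpa using h.symm
  right_inv j := by
    have h := congrArg Prod.fst (autGroup_apply g (g.1⁻¹ (j, 1, 0)).1 (g.1⁻¹ (j, 1, 0)).2.1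
      (g.1⁻¹ (j, 1, 0)).2.2)
    simpa using h.symm

theorem blockPerm_apply (g : autGroup d l) (j : J) : blockPerm g j = (g.1 (j, 1, 0)).1 := rfl

theorem charge_blockPerm {g : autGroup d l} {c : Fˣ}
    (hc : ∀ x, charge d (g.1 x) = c * charge d x) (j : J) :
    signUnit F (g.1 (j, 1, 0)).2.1 * d (blockPerm g j) ^ l = c * d j ^ l := by
  have h := hc (j, 1, 0)
  simpa [charge, blockPerm_apply] using h

theorem tildeClass_blockPerm {g : autGroup d l} {α : Fˣ}
    (hα : ∀ x, charge d (g.1 x) = α ^ l * charge d x) (j : J) :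
    tildeClass l (d (blockPerm g j)) = tildeClass l (α * d j) := by
  have h := congrArg (· ^ 2) (charge_blockPerm hα j)
  simp only [mul_pow, signUnit_pow_two, one_mul] at h
  rw [tildeClass_eq_iff, mul_comm 2 l, pow_mul, h, mul_pow, pow_mul, pow_mul]

/-- If a permutation in `autGroup d l` multiplies the charges by `α ^ l`, then the class of `α`
preserves the multiset of the classes of the `d_j`. -/
theorem tildeClass_mem_multisetStabilizer [Fintype J] {g : autGroup d l} {α : Fˣ}
    (hα : ∀ x, charge d (g.1 x) = α ^ l * charge d x) :
    tildeClass l α ∈ multisetStabilizer (Finset.univ.val.map fun j => tildeClass l (d j)) := by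
  rw [mem_multisetStabilizer, Multiset.map_map]
  have h : (fun a => tildeClass l α * a) ∘ (fun j => tildeClass l (d j))
      = (fun j => tildeClass l (d j)) ∘ blockPerm g := by
    funext j
    simp [tildeClass_blockPerm hα]
  rw [h, ← Multiset.map_map, Multiset.map_univ_val_equiv]

end autGroup

end CycleLabel

/-! ### The group `(S_{m₁} × ⋯ × S_{m_{s'}} × ℤ₂) ⋉ ℤ_l^s` as a permutation group -/

section BlockWeylGroup

open CycleLabel

variable {l s' : ℕ} {m : Fin s' → ℕ}

/-- The action of `(S_{m₁} × ⋯ × S_{m_{s'}} × ℤ₂) ⋉ ℤ_l^s` on the points of the oriented cycles: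
`ℤ_l^s` rotates, the permutations permute the blocks, and the generator of `ℤ₂` exchanges opposite
cycles by `a ↦ -a`. -/
def BlockWeylGroup.act (g : BlockWeylGroup l m) (x : CycleLabel (Σ i, Fin (m i)) l) :
    CycleLabel (Σ i, Fin (m i)) l :=
  (Equiv.Perm.sigmaCongrRightHom _ g.right.1 x.1, g.right.2 * x.2.1,
    Multiplicative.toAdd g.left (Equiv.Perm.sigmaCongrRightHom _ g.right.1 x.1)
      + ((g.right.2 : ℤ) : ZMod l) * x.2.2)

theorem BlockWeylGroup.mul_act (g g' : BlockWeylGroup l m)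
    (x : CycleLabel (Σ i, Fin (m i)) l) : (g * g').act x = g.act (g'.act x) := by
  unfold BlockWeylGroup.act
  ext1
  · simp
  ext1
  · simp [mul_assoc]
  · simp [permSignAction]
    ring

/-- `BlockWeylGroup.act` as a homomorphism to the permutations. -/
def BlockWeylGroup.toPerm (l : ℕ) {s' : ℕ} (m : Fin s' → ℕ) :
    BlockWeylGroup l m →* Equiv.Perm (CycleLabel (Σ i, Fin (m i)) l) :=
  MonoidHom.toHomPerm
    { toFun := fun g => BlockWeylGroup.act g
      map_one' := by
        funext x
        change BlockWeylGroup.act 1 x = x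
        simp [BlockWeylGroup.act]
      map_mul' := fun g g' => funext (BlockWeylGroup.mul_act g g') }

theorem BlockWeylGroup.toPerm_apply (g : BlockWeylGroup l m) (j : Σ i, Fin (m i)) (σ : ℤˣ)
    (a : ZMod l) :
    BlockWeylGroup.toPerm l m g (j, σ, a) = (Equiv.Perm.sigmaCongrRightHom _ g.right.1 j,
      g.right.2 * σ, Multiplicative.toAdd g.left (Equiv.Perm.sigmaCongrRightHom _ g.right.1 j)
        + ((g.right.2 : ℤ) : ZMod l) * a) := rfl

theorem BlockWeylGroup.toPerm_injective [Nonempty (Σ i, Fin (m i))] :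
    Function.Injective (BlockWeylGroup.toPerm l m) := by
  intro g g' h
  have h1 : ∀ j σ a, BlockWeylGroup.toPerm l m g (j, σ, a) =
      BlockWeylGroup.toPerm l m g' (j, σ, a) := fun j σ a => by rw [h]
  simp only [BlockWeylGroup.toPerm_apply, Prod.mk.injEq] at h1
  have hp : g.right.1 = g'.right.1 :=
    Equiv.Perm.sigmaCongrRightHom_injective (Equiv.ext fun j => (h1 j 1 0).1)
  have hs : g.right.2 = g'.right.2 := by
    have h2 := (h1 (Classical.arbitrary _) 1 0).2.1
    simpa using h2
  refine SemidirectProduct.ext ?_ (Prod.ext hp hs)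
  apply Multiplicative.toAdd.injective
  funext j
  have h2 := (h1 ((Equiv.Perm.sigmaCongrRightHom _ g.right.1)⁻¹ j) 1 0).2.2
  simpa [← hp] using h2

theorem exists_sigmaCongrRightHom_eq {s' : ℕ} {m : Fin s' → ℕ} (π : Equiv.Perm (Σ i, Fin (m i)))
    (h : ∀ j, (π j).1 = j.1) :
    ∃ ρ : ∀ i, Equiv.Perm (Fin (m i)), Equiv.Perm.sigmaCongrRightHom _ ρ = π := by
  have h' : ∀ i t, ∃ t', π ⟨i, t⟩ = ⟨i, t'⟩ := by
    intro i t
    have h1 := h ⟨i, t⟩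
    generalize π ⟨i, t⟩ = x at h1
    obtain ⟨i', t'⟩ := x
    obtain rfl : i' = i := h1
    exact ⟨t', rfl⟩
  choose f hf using h'
  have hinj : ∀ i, Function.Injective (f i) := by
    intro i t t' htt
    have h1 : π ⟨i, t⟩ = π ⟨i, t'⟩ := by rw [hf, hf, htt]
    simpa using π.injective h1
  refine ⟨fun i => Equiv.ofBijective (f i) (Finite.injective_iff_bijective.mp (hinj i)), ?_⟩
  ext1 ⟨i, t⟩
  rw [hf]
  rfl

variable {F : Type*} [Field F] (δ : Fin s' → Fˣ)

theorem BlockWeylGroup.charge_toPerm (g : BlockWeylGroup l m) (x : CycleLabel (Σ i, Fin (m i)) l) :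
    charge (fun j => δ j.1) (BlockWeylGroup.toPerm l m g x)
      = signUnit F g.right.2 * charge (fun j => δ j.1) x := by
  obtain ⟨j, σ, a⟩ := x
  rw [BlockWeylGroup.toPerm_apply]
  simp only [charge, map_mul, mul_assoc]
  rfl

theorem BlockWeylGroup.toPerm_mem (g : BlockWeylGroup l m) :
    BlockWeylGroup.toPerm l m g ∈ autGroup (fun j => δ j.1) l := by
  refine ⟨fun x => ?_, fun x => ?_, _, BlockWeylGroup.charge_toPerm δ g⟩
  · obtain ⟨j, σ, a⟩ := x
    simp only [rotate_apply, BlockWeylGroup.toPerm_apply, Units.val_mul, Int.cast_mul]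
    rw [mul_add, add_assoc]
  · obtain ⟨j, σ, a⟩ := x
    simp only [swap_apply, BlockWeylGroup.toPerm_apply, mul_neg]

/-- The embedding of `(S_{m₁} × ⋯ × S_{m_{s'}} × ℤ₂) ⋉ ℤ_l^s` into `autGroup`. -/
def BlockWeylGroup.toAutGroup (l : ℕ) {s' : ℕ} (m : Fin s' → ℕ) {F : Type*} [Field F]
    (δ : Fin s' → Fˣ) :
    BlockWeylGroup l m →* autGroup (fun j : Σ i, Fin (m i) => δ j.1) l :=
  (BlockWeylGroup.toPerm l m).codRestrict _ (BlockWeylGroup.toPerm_mem δ)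

variable {δ}

/-- The group `(S_{m₁} × ⋯ × S_{m_{s'}} × ℤ₂) ⋉ ℤ_l^s` consists of the elements of `autGroup` that
multiply the charges by `±1`. -/
theorem BlockWeylGroup.mem_range_toAutGroup_iff [CharZero F] [NeZero l]
    [Nonempty (Σ i, Fin (m i))] (hδ : Function.Injective fun i => tildeClass l (δ i))
    {g : autGroup (fun j : Σ i, Fin (m i) => δ j.1) l} {c : Fˣ}
    (hc : ∀ x, charge (fun j => δ j.1) (g.1 x) = c * charge (fun j => δ j.1) x) :
    g ∈ (BlockWeylGroup.toAutGroup l m δ).range ↔ c ^ 2 = 1 := by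
  constructor
  · rintro ⟨h, rfl⟩
    have h1 := (hc (Classical.arbitrary _, 1, 0)).symm.trans (BlockWeylGroup.charge_toPerm δ h _)
    rw [mul_right_cancel h1, signUnit_pow_two]
  · intro h
    obtain ⟨τ, rfl⟩ := exists_signUnit_of_sq_eq_one h
    have hch := charge_blockPerm hc
    have hcl : ∀ j, (blockPerm g j).1 = j.1 := by
      intro j
      apply hδ
      have h1 := congrArg (· ^ 2) (hch j)
      simp only [mul_pow, signUnit_pow_two, one_mul] at h1
      simp only
      rw [tildeClass_eq_iff, mul_comm 2 l, pow_mul, pow_mul, h1]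
    obtain ⟨ρ, hρ⟩ := exists_sigmaCongrRightHom_eq (blockPerm g) hcl
    have hτ : ∀ j, (g.1 (j, 1, 0)).2.1 = τ := by
      intro j
      have h1 := hch j
      simp only [hcl] at h1
      exact signUnit_injective (mul_right_cancel h1)
    refine ⟨⟨Multiplicative.ofAdd fun j => (g.1 ((blockPerm g)⁻¹ j, 1, 0)).2.2, (ρ, τ)⟩, ?_⟩
    refine Subtype.ext (Equiv.ext fun x => ?_)
    obtain ⟨j, σ, a⟩ := x
    rw [autGroup_apply g]
    change BlockWeylGroup.toPerm l m _ _ = _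
    rw [BlockWeylGroup.toPerm_apply]
    simp only [hρ, hτ, toAdd_ofAdd, Equiv.Perm.coe_inv, Equiv.symm_apply_apply]
    rfl

theorem BlockWeylGroup.normal_range_toAutGroup [CharZero F] [NeZero l]
    [Nonempty (Σ i, Fin (m i))] (hδ : Function.Injective fun i => tildeClass l (δ i)) :
    (BlockWeylGroup.toAutGroup l m δ).range.Normal := by
  constructor
  intro h hh g
  obtain ⟨c, hc⟩ := h.2.2.2
  obtain ⟨c', hc'⟩ := g.2.2.2
  obtain ⟨c'', hc''⟩ := (g⁻¹).2.2.2
  have h2 := (BlockWeylGroup.mem_range_toAutGroup_iff hδ hc).mp hh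
  have h1 : c' * c'' = 1 := by
    have h3 := hc' (g⁻¹.1 (Classical.arbitrary _))
    rw [hc'', ← mul_assoc] at h3
    have h4 : g.1 (g⁻¹.1 (Classical.arbitrary _)) = (Classical.arbitrary _) :=
      g.1.apply_symm_apply _
    rw [h4] at h3
    exact (mul_eq_right.mp h3.symm)
  refine (BlockWeylGroup.mem_range_toAutGroup_iff hδ (c := c) fun x => ?_).mpr h2
  change charge _ (g.1 (h.1 (g⁻¹.1 x))) = _
  rw [hc', hc, hc'', mul_left_comm, ← mul_assoc c', h1, one_mul]

end BlockWeylGroup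

/-! ### The presentation of the permutation group -/

section Presentation

open CycleLabel

theorem map_univ_sigma_fst {C : Type*} {s' : ℕ} (m : Fin s' → ℕ) (f : Fin s' → C) :
    (Finset.univ : Finset (Σ i, Fin (m i))).val.map (fun j => f j.1)
      = ∑ i, Multiset.replicate (m i) (f i) := by
  have h := Finset.sum_sigma (Finset.univ : Finset (Fin s'))
    (fun i => (Finset.univ : Finset (Fin (m i)))) (fun j => ({f j.1} : Multiset C))
  rw [Finset.univ_sigma_univ] at h
  have h1 : ∀ t : Multiset (Σ i, Fin (m i)),
      t.map (fun j => f j.1) = (t.map (fun j => ({f j.1} : Multiset C))).sum := by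
    intro t
    rw [← Multiset.sum_map_singleton (t.map fun j => f j.1), Multiset.map_map]
    rfl
  rw [h1]
  refine h.trans (Finset.sum_congr rfl fun i _ => ?_)
  simp [Multiset.nsmul_singleton]

variable {F : Type*} [Field F] {l s' : ℕ} {m : Fin s' → ℕ} {δ : Fin s' → Fˣ}

/-- If the class of `ε` preserves the multiset of classes, multiplication by it induces a
permutation `ν` of the classes, preserving multiplicities. -/
theorem exists_perm_classes (hm : ∀ i, 0 < m i)
    (hδ : Function.Injective fun i => tildeClass l (δ i)) {ε : Fˣ}
    (hε : tildeClass l ε ∈ multisetStabilizer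
      ((Finset.univ : Finset (Σ i, Fin (m i))).val.map fun j => tildeClass l (δ j.1))) :
    ∃ ν : Equiv.Perm (Fin s'), (∀ i, m (ν i) = m i) ∧
      ∀ i, tildeClass l (δ (ν i)) = tildeClass l (ε * δ i) := by
  classical
  set M := (Finset.univ : Finset (Σ i, Fin (m i))).val.map fun j => tildeClass l (δ j.1) with hM
  rw [mem_multisetStabilizer] at hε
  have hcount : ∀ i, M.count (tildeClass l (δ i)) = m i := by
    intro i
    rw [hM, map_univ_sigma_fst m (fun i => tildeClass l (δ i)), Multiset.count_sum']
    simp [Multiset.count_replicate, hδ.eq_iff]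
  have h1 : ∀ i, ∃ i', tildeClass l (δ i') = tildeClass l (ε * δ i) := by
    intro i
    have h2 : tildeClass l (δ i) ∈ M := by
      rw [← Multiset.count_pos, hcount]
      exact hm i
    have h3 := Multiset.mem_map_of_mem (fun a => tildeClass l ε * a) h2
    rw [hε, hM, Multiset.mem_map] at h3
    obtain ⟨j, -, hj⟩ := h3
    exact ⟨j.1, by rw [hj, map_mul]⟩
  choose ν hν using h1
  have hinj : Function.Injective ν := by
    intro i i' h
    have h2 := hν i
    rw [h, hν i', map_mul, map_mul] at h2
    exact (hδ (mul_left_cancel h2)).symm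
  refine ⟨Equiv.ofBijective ν (Finite.injective_iff_bijective.mp hinj), fun i => ?_, hν⟩
  have h2 := count_map_mul M (tildeClass l ε) (tildeClass l (δ (ν i)))
  rw [hε] at h2
  rw [hν i, map_mul, inv_mul_cancel_left, ← map_mul, ← hν] at h2
  rw [← hcount i]
  change m (ν i) = _
  rw [← hcount (ν i)]
  convert h2

/-- The permutation of the blocks carrying the `t`-th block of the `i`-th class to the `t`-th
block of the class `ν i`. -/
def permBlocks (ν : Equiv.Perm (Fin s')) (hν : ∀ i, m (ν i) = m i) :
    Equiv.Perm (Σ i, Fin (m i)) :=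
  Equiv.sigmaCongr ν fun i => finCongr (hν i).symm

theorem permBlocks_apply (ν : Equiv.Perm (Fin s')) (hν : ∀ i, m (ν i) = m i)
    (j : Σ i, Fin (m i)) : permBlocks ν hν j = ⟨ν j.1, Fin.cast (hν j.1).symm j.2⟩ := rfl

theorem permBlocks_pow_apply (ν : Equiv.Perm (Fin s')) (hν : ∀ i, m (ν i) = m i) (n : ℕ)
    (j : Σ i, Fin (m i)) :
    ((permBlocks ν hν ^ n) j).1 = (ν ^ n) j.1 ∧
      (((permBlocks ν hν ^ n) j).2 : ℕ) = j.2 := by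
  induction n with
  | zero => exact ⟨rfl, rfl⟩
  | succ n ih =>
    rw [pow_succ', pow_succ']
    simp only [Equiv.Perm.mul_apply, permBlocks_apply]
    exact ⟨by rw [ih.1], by rw [← ih.2]; rfl⟩

theorem permBlocks_pow_eq_one {ν : Equiv.Perm (Fin s')} (hν : ∀ i, m (ν i) = m i) {n : ℕ}
    (h : ν ^ n = 1) : permBlocks ν hν ^ n = 1 := by
  ext1 j
  obtain ⟨h1, h2⟩ := permBlocks_pow_apply ν hν n j
  rw [h] at h1
  generalize (permBlocks ν hν ^ n) j = x at h1 h2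
  obtain ⟨i, t⟩ := x
  obtain ⟨i', t'⟩ := j
  obtain rfl : i = i' := h1
  obtain rfl : t = t' := Fin.ext h2
  rfl

/-- A lift of the root of unity `ε` to the permutation group: it permutes the blocks by a
permutation `π` carrying the class of `δ` to that of `ε δ` and multiplies the charges by `ε ^ l`.
It is chosen without rotations, so that its `q`-th power exchanges the two cycles of each block by
`a ↦ -a`. -/
theorem exists_autGroup_lift [CharZero F] (hl : Odd l) (hm : ∀ i, 0 < m i)
    (hδ : Function.Injective fun i => tildeClass l (δ i)) {q : ℕ}
    {ε : Fˣ} (hεp : IsPrimitiveRoot ε (2 * l * q)) (hq : 0 < q)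
    (hε : tildeClass l ε ∈ multisetStabilizer
      ((Finset.univ : Finset (Σ i, Fin (m i))).val.map fun j => tildeClass l (δ j.1))) :
    ∃ (g : autGroup (fun j : Σ i, Fin (m i) => δ j.1) l) (π : Equiv.Perm (Σ i, Fin (m i)))
      (τ : Fin s' → ℤˣ),
      (∀ j, tildeClass l (ε * δ j.1) = tildeClass l (δ (π j).1)) ∧
      (∀ j σ a, g.1 (j, σ, a) = (π j, τ j.1 * σ, ((τ j.1 : ℤ) : ZMod l) * a)) ∧
      (∀ x, charge (fun j => δ j.1) (g.1 x) = ε ^ l * charge (fun j => δ j.1) x) ∧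
      (∀ j σ a, (g ^ q).1 (j, σ, a) = (j, -σ, -a)) := by
  obtain ⟨ν, hνm, hν⟩ := exists_perm_classes hm hδ hε
  have h1 : ∀ i, ∃ τ : ℤˣ, signUnit F τ * δ (ν i) ^ l = ε ^ l * δ i ^ l := by
    intro i
    have h2 := tildeClass_eq_iff.mp (hν i)
    rw [mul_comm 2 l, pow_mul, pow_mul] at h2
    obtain ⟨τ, hτ⟩ := exists_signUnit_of_sq_eq_one
      (a := (ε * δ i) ^ l / δ (ν i) ^ l) (by rw [div_pow, h2, div_self'])
    exact ⟨τ, by rw [← hτ, div_mul_cancel, mul_pow]⟩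
  choose τ hτ using h1
  set π := permBlocks ν hνm with hπ
  let g : Equiv.Perm (CycleLabel (Σ i, Fin (m i)) l) :=
    { toFun := fun x => (π x.1, τ x.1.1 * x.2.1, ((τ x.1.1 : ℤ) : ZMod l) * x.2.2)
      invFun := fun x => (π.symm x.1, τ (π.symm x.1).1 * x.2.1,
        ((τ (π.symm x.1).1 : ℤ) : ZMod l) * x.2.2)
      left_inv := by
        rintro ⟨j, σ, a⟩
        simp only [Equiv.symm_apply_apply]
        rw [← mul_assoc, ← mul_assoc, units_int_sq_zmod, Int.units_mul_self, one_mul, one_mul]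
      right_inv := by
        rintro ⟨j, σ, a⟩
        simp only [Equiv.apply_symm_apply]
        rw [← mul_assoc, ← mul_assoc, units_int_sq_zmod, Int.units_mul_self, one_mul, one_mul] }
  have hg : ∀ j σ a, g (j, σ, a) = (π j, τ j.1 * σ, ((τ j.1 : ℤ) : ZMod l) * a) :=
    fun _ _ _ => rfl
  have hch : ∀ x, charge (fun j => δ j.1) (g x) = ε ^ l * charge (fun j => δ j.1) x := by
    rintro ⟨j, σ, a⟩
    rw [hg]
    simp only [charge, map_mul]
    have h2 := hτ j.1
    change _ * δ (ν j.1) ^ l = _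
    rw [mul_comm (signUnit F (τ j.1)), mul_assoc, h2, mul_left_comm]
  have hmem : g ∈ autGroup (fun j : Σ i, Fin (m i) => δ j.1) l := by
    refine ⟨?_, ?_, _, hch⟩
    · rintro ⟨j, σ, a⟩
      rw [rotate_apply, hg, hg, rotate_apply, mul_add, Units.val_mul, Int.cast_mul]
    · rintro ⟨j, σ, a⟩
      rw [swap_apply, hg, hg, swap_apply, mul_neg]
  have hνq : ν ^ q = 1 := by
    have h2 : ∀ n i, tildeClass l (δ ((ν ^ n) i)) = tildeClass l (ε ^ n * δ i) := by
      intro n i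
      induction n with
      | zero => simp
      | succ n ih => rw [pow_succ', Equiv.Perm.mul_apply, hν, map_mul, ih, ← map_mul,
          ← mul_assoc, ← pow_succ']
    ext1 i
    apply hδ
    simp only
    rw [h2, tildeClass_eq_iff, mul_pow, ← pow_mul, mul_comm q, hεp.pow_eq_one, one_mul]
    rfl
  have hpow : ∀ n j, ∃ T : ℤˣ, ∀ σ a,
      (g ^ n) (j, σ, a) = ((π ^ n) j, T * σ, ((T : ℤ) : ZMod l) * a) := by
    intro n j
    induction n with
    | zero => exact ⟨1, fun σ a => by simp⟩
    | succ n ih =>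
      obtain ⟨T, hT⟩ := ih
      refine ⟨τ ((π ^ n) j).1 * T, fun σ a => ?_⟩
      rw [pow_succ', Equiv.Perm.mul_apply, hT, hg, pow_succ', Equiv.Perm.mul_apply]
      simp [mul_assoc]
  have hchpow : ∀ n x, charge (fun j => δ j.1) ((g ^ n) x)
      = (ε ^ l) ^ n * charge (fun j => δ j.1) x := by
    intro n x
    induction n with
    | zero => simp
    | succ n ih => rw [pow_succ', Equiv.Perm.mul_apply, hch, ih, ← mul_assoc, ← pow_succ']
  have hεlq : (ε ^ l) ^ q = signUnit F (-1) := by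
    have h2 := hεp.pow (n := 2 * l * q) (a := l * q) (b := 2) (by
      have := hl.pos; positivity) (by ring)
    rw [← pow_mul, signUnit_neg, map_one]
    exact Units.ext (by
      have h3 := (IsPrimitiveRoot.coe_units_iff.mpr h2).eq_neg_one_of_two_right
      exact h3)
  refine ⟨⟨g, hmem⟩, π, τ, fun j => (hν j.1).symm, hg, hch, fun j σ a => ?_⟩
  obtain ⟨T, hT⟩ := hpow q j
  have hπq : π ^ q = 1 := permBlocks_pow_eq_one hνm hνq
  have h2 := hchpow q (j, 1, 0)
  rw [hT, hεlq, hπq] at h2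
  simp only [charge, mul_one, map_one, one_mul, Equiv.Perm.one_apply] at h2
  obtain rfl : T = -1 := signUnit_injective (mul_right_cancel h2)
  change (g ^ q) _ = _
  rw [hT, hπq]
  simp

/-- The group `autGroup` is the quotient of `((S_{m₁} × ⋯ × S_{m_{s'}} × ℤ₂) ⋉ ℤ_l^s) ⋊ ℤ_p`,
`p = 2lq`, by a cyclic group of order `2l`. -/
theorem exists_autGroup_presentation [IsAlgClosed F] [CharZero F] (hl : Odd l) (hm : ∀ i, 0 < m i)
    (hδ : Function.Injective fun i => tildeClass l (δ i)) [Nonempty (Σ i, Fin (m i))] {q : ℕ}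
    (hq : 0 < q) (hstab : ∀ α : Fˣ, tildeClass l α ∈ multisetStabilizer
      ((Finset.univ : Finset (Σ i, Fin (m i))).val.map fun j => tildeClass l (δ j.1)) ↔
        α ^ (2 * l * q) = 1)
    {ε : Fˣ} (hε : IsPrimitiveRoot ε (2 * l * q)) :
    ∃ (φ : Multiplicative (ZMod (2 * l * q)) →* MulAut (BlockWeylGroup l m))
      (π : Equiv.Perm (Σ i, Fin (m i))) (τ : (Σ i, Fin (m i)) → ℤˣ)
      (w : BlockWeylGroup l m)
      (K : Subgroup (BlockWeylGroup l m ⋊[φ] Multiplicative (ZMod (2 * l * q)))) (_ : K.Normal),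
      (∀ j, tildeClass l (ε * δ j.1) = tildeClass l (δ (π j).1)) ∧
      IsInducedByBlockPerm (φ (Multiplicative.ofAdd 1)) π τ ∧
      K = Subgroup.zpowers
        (SemidirectProduct.inr (Multiplicative.ofAdd 1) ^ q * (SemidirectProduct.inl w)⁻¹) ∧
      Nonempty (K ≃* Multiplicative (ZMod (2 * l * q / q))) ∧
      Nonempty (autGroup (fun j : Σ i, Fin (m i) => δ j.1) l ≃*
        (BlockWeylGroup l m ⋊[φ] Multiplicative (ZMod (2 * l * q))) ⧸ K) := by
  have hl0 : 0 < l := hl.pos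
  have : NeZero l := ⟨hl0.ne'⟩
  have : NeZero (2 * l * q) := ⟨by positivity⟩
  obtain ⟨g, π, τ, hπ, hg, hch, hgq⟩ :=
    exists_autGroup_lift hl hm hδ hε hq ((hstab ε).mpr hε.pow_eq_one)
  have hnormal := BlockWeylGroup.normal_range_toAutGroup (l := l) (m := m) hδ
  have hinj : Function.Injective (BlockWeylGroup.toAutGroup l m δ) := fun a b h =>
    BlockWeylGroup.toPerm_injective (congrArg Subtype.val h)
  have hchpow : ∀ (n : ℕ) x, charge (fun j => δ j.1) ((g ^ n).1 x)
      = (ε ^ n) ^ l * charge (fun j => δ j.1) x := by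
    intro n x
    induction n with
    | zero => simp
    | succ n ih =>
      rw [pow_succ', pow_succ']
      change charge _ (g.1 ((g ^ n).1 x)) = _
      rw [hch, ih, mul_pow, mul_assoc]
  let w : BlockWeylGroup l m := ⟨1, (1, -1)⟩
  have hw : BlockWeylGroup.toAutGroup l m δ w = g ^ q := by
    refine Subtype.ext (Equiv.ext fun x => ?_)
    obtain ⟨j, σ, a⟩ := x
    rw [hgq]
    change BlockWeylGroup.toPerm l m w _ = _
    rw [BlockWeylGroup.toPerm_apply]
    simp [w]
  have hgp : g ^ (2 * l * q) = 1 := by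
    have h2 : (g ^ q) ^ 2 = 1 := by
      refine Subtype.ext (Equiv.ext fun x => ?_)
      obtain ⟨j, σ, a⟩ := x
      rw [pow_two]
      change (g ^ q).1 ((g ^ q).1 _) = _
      rw [hgq, hgq]
      simp
    rw [show 2 * l * q = q * 2 * l by ring, pow_mul, pow_mul, h2, one_pow]
  -- If `x` multiplies the charges by `α ^ l`, then `α` is a power `ε ^ t`, and `x g⁻ᵗ` preserves
  -- the charges.
  have hgen : ∀ x, ∃ (h : BlockWeylGroup l m) (t : ℕ),
      x = BlockWeylGroup.toAutGroup l m δ h * g ^ t := by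
    intro x
    obtain ⟨c, hc⟩ := x.2.2.2
    obtain ⟨a, ha⟩ := IsAlgClosed.exists_pow_nat_eq (c : F) hl0
    have ha0 : a ≠ 0 := by
      rintro rfl
      rw [zero_pow hl0.ne'] at ha
      exact c.ne_zero ha.symm
    obtain ⟨α, rfl⟩ : ∃ α : Fˣ, c = α ^ l :=
      ⟨Units.mk0 a ha0, Units.ext (by simpa using ha.symm)⟩
    have h1 := (hstab α).mp (tildeClass_mem_multisetStabilizer hc)
    obtain ⟨t, -, ht⟩ := (IsPrimitiveRoot.coe_units_iff.mpr hε).eq_pow_of_pow_eq_one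
      (ξ := (α : F)) (by simpa using congrArg Units.val h1)
    obtain rfl : ε ^ t = α := Units.ext (by simpa using ht)
    have h2 : x * (g ^ t)⁻¹ ∈ (BlockWeylGroup.toAutGroup l m δ).range := by
      refine (BlockWeylGroup.mem_range_toAutGroup_iff hδ (c := 1) fun y => ?_).mpr (one_pow 2)
      change charge _ (x.1 ((g ^ t).1.symm y)) = _
      have h3 := hchpow t ((g ^ t).1.symm y)
      rw [Equiv.apply_symm_apply] at h3
      rw [hc, ← h3, one_mul]
    obtain ⟨h, hh⟩ := h2
    exact ⟨h, t, by rw [hh, inv_mul_cancel_right]⟩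
  have hmin : ∀ t : ℕ, g ^ t ∈ (BlockWeylGroup.toAutGroup l m δ).range → q ∣ t := by
    intro t ht
    have h1 := (BlockWeylGroup.mem_range_toAutGroup_iff hδ (hchpow t)).mp ht
    rw [← pow_mul, ← pow_mul, hε.pow_eq_one_iff_dvd, show t * (l * 2) = 2 * l * t by ring,
      Nat.mul_dvd_mul_iff_left (by positivity)] at h1
    exact h1
  obtain ⟨φ, hφ, K, hK, hKeq, hKcard, hquot⟩ := exists_semidirectProduct_quotient_equiv
    (BlockWeylGroup.toAutGroup l m δ) hinj g (Dvd.intro_left _ rfl) w hw hgp hgen hmin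
  refine ⟨φ, π, fun j => τ j.1, w, K, hK, hπ, fun h => ?_, hKeq, hKcard, hquot⟩
  -- Both sides of `h' g = g h`, `h'` the image of `h`, are evaluated at the points.
  have h1 : ∀ x, BlockWeylGroup.toPerm l m (φ (Multiplicative.ofAdd 1) h) (g.1 x)
      = g.1 (BlockWeylGroup.toPerm l m h x) := by
    intro x
    have h2 := hφ h
    rw [eq_mul_inv_iff_mul_eq] at h2
    exact congrArg (fun y => y.1 x) h2
  generalize φ (Multiplicative.ofAdd 1) h = h' at h1
  have h2 := fun j σ a => h1 (j, σ, a)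
  simp only [hg, BlockWeylGroup.toPerm_apply, Prod.mk.injEq] at h2
  have hcl : ∀ j, (Equiv.Perm.sigmaCongrRightHom (fun i => Fin (m i)) h.right.1 j).1 = j.1 :=
    fun j => rfl
  have hperm : ∀ j, Equiv.Perm.sigmaCongrRightHom _ h'.right.1 (π j)
      = π (Equiv.Perm.sigmaCongrRightHom _ h.right.1 j) := fun j => (h2 j 1 0).1
  refine ⟨fun j => ?_, ?_, ?_⟩
  · obtain ⟨j, rfl⟩ := (Equiv.Perm.sigmaCongrRightHom (fun i => Fin (m i)) h.right.1).surjective j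
    have h3 := (h2 j 1 0).2.2
    simp only [mul_zero, add_zero, hperm] at h3
    rw [h3, zsmul_eq_mul]
  · rw [eq_mul_inv_iff_mul_eq]
    exact Equiv.ext hperm
  · have h3 := (h2 (Classical.arbitrary _) 1 0).2.1
    rw [hcl, mul_one, mul_one, mul_comm (τ _)] at h3
    exact mul_right_cancel h3

end Presentation

/-! ### Bases adapted to the oriented cycles -/

section CycleBasis

open CycleLabel

/-- A function `f` on `ℤ_l` with product `1` is a multiplicative coboundary: this makes it possible
to rescale vectors along a cycle of length `l` with prescribed ratios. -/
theorem exists_zmod_coboundary {A : Type*} [CommGroup A] {l : ℕ} [NeZero l] (f : ZMod l → A)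
    (hf : ∏ a, f a = 1) : ∃ ω : ZMod l → A, ω 0 = 1 ∧ ∀ a, ω (a + 1) = ω a * f a := by
  refine ⟨fun a => ∏ k ∈ Finset.range a.val, f k, by simp, fun a => ?_⟩
  have h1 : (∏ k ∈ Finset.range a.val, f k) * f a
      = ∏ k ∈ Finset.range (a.val + 1), f (k : ZMod l) := by
    rw [Finset.prod_range_succ, ZMod.natCast_zmod_val]
  simp only
  rw [h1]
  have h2 := ZMod.val_lt a
  rcases Nat.lt_or_ge (a.val + 1) l with h | h
  · have h3 : a + 1 = ((a.val + 1 : ℕ) : ZMod l) := by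
      rw [Nat.cast_add, ZMod.natCast_zmod_val, Nat.cast_one]
    rw [h3, ZMod.val_cast_of_lt h]
  · have h3 : a.val + 1 = l := by omega
    have h4 : a + 1 = 0 := by
      rw [← ZMod.natCast_zmod_val a, ← Nat.cast_one, ← Nat.cast_add, h3, ZMod.natCast_self]
    rw [h3, h4, ZMod.val_zero, Finset.prod_range_zero, ← hf]
    refine Finset.prod_nbij' (fun a => a.val) (fun k => (k : ZMod l)) ?_ ?_ ?_ ?_ ?_
    · intro a _; exact Finset.mem_range.mpr (ZMod.val_lt a)
    · intro k _; exact Finset.mem_univ _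
    · intro a _; exact ZMod.natCast_zmod_val a
    · intro k hk; exact ZMod.val_cast_of_lt (Finset.mem_range.mp hk)
    · intro a _; rw [ZMod.natCast_zmod_val]

variable {F L J : Type*} [Field F] [LieRing L] [LieAlgebra F L] {l : ℕ}

/-- The scalar `σ d_j` attached to a step along the cycle of sign `σ` of the block `j`. -/
def stepScalar (d : J → Fˣ) (x : CycleLabel J l) : Fˣ := signUnit F x.2.1 * d x.1

theorem stepScalar_pow {d : J → Fˣ} (hl : Odd l) (x : CycleLabel J l) :
    stepScalar d x ^ l = charge d x := by
  rw [stepScalar, charge, mul_pow, signUnit_pow_odd _ hl]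

theorem stepScalar_rotate {d : J → Fˣ} (x : CycleLabel J l) :
    stepScalar d (rotate x) = stepScalar d x := rfl

/-- A basis of a Lie algebra `L` consisting of a central vector `z`, with label `inl false`, a
vector `u`, with label `inl true`, and vectors `v_x` indexed by the points of the oriented cycles
such that `ad u` moves `v_x` one step along the cycle and the only nonzero brackets of the `v_x`
are those of a point and the opposite one, with scalars `±χ_j`. -/
structure IsCycleBasis (b : Module.Basis (Bool ⊕ CycleLabel J l) F L) (d χ : J → Fˣ) : Prop where
  z_lie : ∀ a : L, ⁅b (Sum.inl false), a⁆ = 0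
  u_lie : ∀ x, ⁅b (Sum.inl true), b (Sum.inr x)⁆
    = (stepScalar d x : F) • b (Sum.inr (rotate x))
  lie_swap : ∀ x, ⁅b (Sum.inr x), b (Sum.inr (swap x))⁆
    = (stepScalar χ x : F) • b (Sum.inl false)
  lie_of_ne : ∀ x y, y ≠ swap x → ⁅b (Sum.inr x), b (Sum.inr y)⁆ = 0

theorem mem_lieAut_of_basis {ι : Type*} (b : Module.Basis ι F L) {f : L ≃ₗ[F] L}
    (h : ∀ i j, f ⁅b i, b j⁆ = ⁅f (b i), f (b j)⁆) : f ∈ lieAut F L := by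
  let B : L →ₗ[F] L →ₗ[F] L := LinearMap.mk₂ F (fun x y => f ⁅x, y⁆) (by simp) (by simp)
    (by simp) (by simp)
  let B' : L →ₗ[F] L →ₗ[F] L := LinearMap.mk₂ F (fun x y => ⁅f x, f y⁆) (by simp) (by simp)
    (by simp) (by simp)
  have hB : B = B' := LinearMap.ext_basis b b h
  intro x y
  exact congrArg (fun T => T x y) hB

theorem basis_index_eq_of_smul_eq_smul {ι : Type*} (b : Module.Basis ι F L) {i j : ι} {k k' : F}
    (hk : k ≠ 0) (h : k • b i = k' • b j) : i = j := by
  by_contra hij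
  have h1 := congrArg (fun x => b.repr x i) h
  simp [Ne.symm hij] at h1
  exact hk h1

namespace IsCycleBasis

variable {b : Module.Basis (Bool ⊕ CycleLabel J l) F L} {d χ : J → Fˣ}

theorem lie_z (hb : IsCycleBasis b d χ) (a : L) : ⁅a, b (Sum.inl false)⁆ = 0 := by
  rw [← lie_skew, hb.z_lie, neg_zero]

theorem repr_lie_u (hb : IsCycleBasis b d χ) (a a' : L) :
    b.repr ⁅a, a'⁆ (Sum.inl true) = 0 := by
  let B : L →ₗ[F] L →ₗ[F] F := LinearMap.mk₂ F (fun x y => b.repr ⁅x, y⁆ (Sum.inl true))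
    (by simp) (by simp) (by simp) (by simp)
  have hux : ∀ x, b.repr ⁅b (Sum.inl true), b (Sum.inr x)⁆ (Sum.inl true) = 0 := by
    intro x
    rw [hb.u_lie]
    simp
  have hB : B = 0 := by
    refine LinearMap.ext_basis b b fun i j => ?_
    change b.repr ⁅b i, b j⁆ (Sum.inl true) = 0
    rcases i with (_ | _) | x
    · simp [hb.z_lie]
    · rcases j with (_ | _) | y
      · simp [hb.lie_z]
      · simp
      · exact hux y
    · rcases j with (_ | _) | y
      · simp [hb.lie_z]
      · rw [← lie_skew, map_neg, Finsupp.neg_apply, hux, neg_zero]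
      · by_cases h : y = swap x
        · rw [h, hb.lie_swap]
          simp
        · rw [hb.lie_of_ne x y h]
          simp
  exact congrArg (fun T => T a a') hB

/-- All basis vectors but `u` are brackets. -/
theorem exists_lie_eq (hb : IsCycleBasis b d χ) [Nonempty (CycleLabel J l)]
    {c : Bool ⊕ CycleLabel J l} (hc : c ≠ Sum.inl true) : ∃ a a' : L, ⁅a, a'⁆ = b c := by
  rcases c with (_ | _) | x
  · let x : CycleLabel J l := Classical.arbitrary _
    refine ⟨(stepScalar χ x : F)⁻¹ • b (Sum.inr x), b (Sum.inr (swap x)), ?_⟩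
    rw [smul_lie, hb.lie_swap, smul_smul, inv_mul_cancel₀ (Units.ne_zero _), one_smul]
  · exact absurd rfl hc
  · refine ⟨(stepScalar d (rotate.symm x) : F)⁻¹ • b (Sum.inl true),
      b (Sum.inr (rotate.symm x)), ?_⟩
    rw [smul_lie, hb.u_lie, smul_smul, inv_mul_cancel₀ (Units.ne_zero _), one_smul,
      Equiv.apply_symm_apply]

/-- No basis vector but `z` is central. -/
theorem exists_lie_ne_zero (hb : IsCycleBasis b d χ) [Nonempty (CycleLabel J l)]
    {c : Bool ⊕ CycleLabel J l} (hc : c ≠ Sum.inl false) : ∃ a : L, ⁅b c, a⁆ ≠ 0 := by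
  rcases c with (_ | _) | x
  · exact absurd rfl hc
  · refine ⟨b (Sum.inr (Classical.arbitrary _)), ?_⟩
    rw [hb.u_lie]
    exact smul_ne_zero (Units.ne_zero _) (b.ne_zero _)
  · refine ⟨b (Sum.inr (swap x)), ?_⟩
    rw [hb.lie_swap]
    exact smul_ne_zero (Units.ne_zero _) (b.ne_zero _)

/-- The labels of `z` and `u` are fixed by every automorphism permuting the lines of the basis. -/
theorem label_eq_iff (hb : IsCycleBasis b d χ) [Nonempty (CycleLabel J l)] {f : L ≃ₗ[F] L}
    (hf : f ∈ lieAut F L) {c c' : Bool ⊕ CycleLabel J l} {k : Fˣ} (h : f (b c) = (k : F) • b c') :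
    (c = Sum.inl true ↔ c' = Sum.inl true) ∧ (c = Sum.inl false ↔ c' = Sum.inl false) := by
  have key : ∀ {f : L ≃ₗ[F] L}, f ∈ lieAut F L → ∀ {c c' : Bool ⊕ CycleLabel J l} {k : Fˣ},
      f (b c) = (k : F) • b c' →
      (c' = Sum.inl true → c = Sum.inl true) ∧ (c = Sum.inl false → c' = Sum.inl false) := by
    intro f hf c c' k h
    constructor
    · rintro rfl
      by_contra hc
      obtain ⟨a, a', haa⟩ := hb.exists_lie_eq hc
      have h1 := hb.repr_lie_u (f a) (f a')
      rw [← hf, haa, h] at h1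
      simp at h1
    · rintro rfl
      by_contra hc
      obtain ⟨a, ha⟩ := hb.exists_lie_ne_zero hc
      apply ha
      have h1 := hf (b (Sum.inl false)) (f.symm a)
      rw [hb.z_lie, map_zero, h, LinearEquiv.apply_symm_apply, smul_lie] at h1
      exact (smul_eq_zero_iff_right (Units.ne_zero k)).mp h1.symm
  have h' : f⁻¹ (b c') = ((k⁻¹ : Fˣ) : F) • b c := by
    have h1 : f (((k⁻¹ : Fˣ) : F) • b c) = b c' := by
      rw [map_smul, h, smul_smul, ← Units.val_mul, inv_mul_cancel, Units.val_one, one_smul]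
    rw [← h1]
    exact f.symm_apply_apply _
  have k1 := key hf h
  have k2 := key ((lieAut F L).inv_mem hf) h'
  exact ⟨⟨k2.1, k1.1⟩, ⟨k1.2, k2.2⟩⟩

/-- An automorphism permuting the lines of the basis induces a permutation of the points of the
oriented cycles that belongs to `autGroup d l`. -/
theorem exists_autGroup_of_lieAut (hb : IsCycleBasis b d χ) (hl : Odd l)
    [Nonempty (CycleLabel J l)] {f : L ≃ₗ[F] L}
    (hf : f ∈ lieAut F L) (hlines : ∀ c, ∃ c', ∃ k : Fˣ, f (b c) = (k : F) • b c')
    (hlines' : ∀ c, ∃ c', ∃ k : Fˣ, f⁻¹ (b c) = (k : F) • b c') :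
    (∃ α : Fˣ, f (b (Sum.inl true)) = (α : F) • b (Sum.inl true)) ∧
    (∃ ζ : Fˣ, f (b (Sum.inl false)) = (ζ : F) • b (Sum.inl false)) ∧
    ∃ g : autGroup d l, ∀ x, ∃ k : Fˣ, f (b (Sum.inr x)) = (k : F) • b (Sum.inr (g.1 x)) := by
  have key : ∀ {f : L ≃ₗ[F] L}, f ∈ lieAut F L →
      (∀ c, ∃ c', ∃ k : Fˣ, f (b c) = (k : F) • b c') →
      ∀ x, ∃ y, ∃ k : Fˣ, f (b (Sum.inr x)) = (k : F) • b (Sum.inr y) := by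
    intro f hf hlines x
    obtain ⟨c', k, h⟩ := hlines (Sum.inr x)
    have h1 := hb.label_eq_iff hf h
    rcases c' with (_ | _) | y
    · simp at h1
    · simp at h1
    · exact ⟨y, k, h⟩
  obtain ⟨α, hα⟩ : ∃ α : Fˣ, f (b (Sum.inl true)) = (α : F) • b (Sum.inl true) := by
    obtain ⟨c', k, h⟩ := hlines (Sum.inl true)
    obtain rfl := (hb.label_eq_iff hf h).1.mp rfl
    exact ⟨k, h⟩
  obtain ⟨ζ, hζ⟩ : ∃ ζ : Fˣ, f (b (Sum.inl false)) = (ζ : F) • b (Sum.inl false) := by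
    obtain ⟨c', k, h⟩ := hlines (Sum.inl false)
    obtain rfl := (hb.label_eq_iff hf h).2.mp rfl
    exact ⟨k, h⟩
  refine ⟨⟨α, hα⟩, ⟨ζ, hζ⟩, ?_⟩
  choose g k hg using key hf hlines
  choose g' k' hg' using key ((lieAut F L).inv_mem hf) hlines'
  have hgg' : ∀ x, g (g' x) = x := by
    intro x
    have h1 : f (f⁻¹ (b (Sum.inr x))) = b (Sum.inr x) := f.apply_symm_apply _
    rw [hg', map_smul, hg, smul_smul] at h1
    exact Sum.inr_injective (basis_index_eq_of_smul_eq_smul b (k' := 1)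
      (mul_ne_zero (Units.ne_zero _) (Units.ne_zero _)) (by rw [h1, one_smul]))
  have hg'g : ∀ x, g' (g x) = x := by
    intro x
    have h1 : f⁻¹ (f (b (Sum.inr x))) = b (Sum.inr x) := f.symm_apply_apply _
    rw [hg, map_smul, hg', smul_smul] at h1
    exact Sum.inr_injective (basis_index_eq_of_smul_eq_smul b (k' := 1)
      (mul_ne_zero (Units.ne_zero _) (Units.ne_zero _)) (by rw [h1, one_smul]))
  have hstep : ∀ x, ((stepScalar d x : F) * (k (rotate x) : F)) • b (Sum.inr (g (rotate x)))
      = ((α : F) * (k x : F) * (stepScalar d (g x) : F)) • b (Sum.inr (rotate (g x))) := by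
    intro x
    have h1 := hf (b (Sum.inl true)) (b (Sum.inr x))
    rw [hb.u_lie, map_smul, hg, hα, hg, smul_lie, lie_smul, hb.u_lie, smul_smul, smul_smul,
      smul_smul] at h1
    rw [h1, mul_assoc]
  have hrot : ∀ x, g (rotate x) = rotate (g x) := fun x =>
    Sum.inr_injective (basis_index_eq_of_smul_eq_smul b
      (mul_ne_zero (Units.ne_zero _) (Units.ne_zero _)) (hstep x))
  have hswap : ∀ x, g (swap x) = swap (g x) := by
    intro x
    by_contra h
    have h1 := hf (b (Sum.inr x)) (b (Sum.inr (swap x)))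
    rw [hb.lie_swap, map_smul, hζ, hg, hg, smul_lie, lie_smul, hb.lie_of_ne _ _ h, smul_zero,
      smul_zero, smul_smul] at h1
    exact smul_ne_zero (mul_ne_zero (Units.ne_zero _) (Units.ne_zero _)) (b.ne_zero _) h1
  have hk : ∀ x, k (rotate x) = k x * (α * stepScalar d (g x) / stepScalar d x) := by
    intro x
    have h1 := hstep x
    rw [hrot] at h1
    have h2 := smul_left_injective F (b.ne_zero (Sum.inr (rotate (g x)))) h1
    have h3 : stepScalar d x * k (rotate x) = α * k x * stepScalar d (g x) := Units.ext h2
    rw [mul_div_assoc', eq_div_iff_mul_eq', mul_comm _ (stepScalar d x), h3,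
      mul_assoc, mul_left_comm]
  have hstepn : ∀ (n : ℕ) (x : CycleLabel J l), stepScalar d ((rotate ^ n) x) = stepScalar d x := by
    intro n x
    induction n with
    | zero => rfl
    | succ n ih => rw [pow_succ', Equiv.Perm.mul_apply, stepScalar_rotate, ih]
  -- Going once around a cycle of length `l` compares the charges.
  have hiter : ∀ (n : ℕ) x, g ((rotate ^ n) x) = (rotate ^ n) (g x) ∧
      k ((rotate ^ n) x) = k x * (α * stepScalar d (g x) / stepScalar d x) ^ n := by
    intro n x
    induction n with
    | zero => simp
    | succ n ih =>
      rw [pow_succ', Equiv.Perm.mul_apply, Equiv.Perm.mul_apply]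
      refine ⟨by rw [hrot, ih.1], ?_⟩
      rw [hk, ih.1, ih.2, hstepn, hstepn, pow_succ, mul_assoc]
  have hrotl : ∀ x : CycleLabel J l, (rotate ^ l) x = x := by
    rintro ⟨j, σ, a⟩
    have h1 : ∀ n : ℕ, (rotate ^ n) (j, σ, a) = (j, σ, a + n * ((σ : ℤ) : ZMod l)) := by
      intro n
      induction n with
      | zero => simp
      | succ n ih =>
        rw [pow_succ', Equiv.Perm.mul_apply, ih, rotate_apply]
        push_cast
        rw [add_mul, one_mul, add_assoc]
    rw [h1]
    simp
  refine ⟨⟨⟨g, g', hg'g, hgg'⟩, hrot, hswap, (α ^ l)⁻¹, fun x => ?_⟩, fun x => ⟨k x, hg x⟩⟩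
  have h1 := (hiter l x).2
  rw [hrotl, eq_comm, mul_eq_left, div_pow, mul_pow, stepScalar_pow hl, stepScalar_pow hl,
    div_eq_one] at h1
  exact eq_inv_mul_of_mul_eq h1

/-- Every element of `autGroup d l` is induced by an automorphism. -/
theorem exists_lieAut_of_autGroup [IsAlgClosed F] (hb : IsCycleBasis b d χ) (hl : Odd l)
    (g : autGroup d l) :
    ∃ f ∈ lieAut F L, (∃ α : Fˣ, f (b (Sum.inl true)) = (α : F) • b (Sum.inl true)) ∧
      (∃ ζ : Fˣ, f (b (Sum.inl false)) = (ζ : F) • b (Sum.inl false)) ∧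
      ∀ x, ∃ k : Fˣ, f (b (Sum.inr x)) = (k : F) • b (Sum.inr (g.1 x)) := by
  have hl0 : 0 < l := hl.pos
  have : NeZero l := ⟨hl0.ne'⟩
  obtain ⟨hrot, hswap, c, hc⟩ := g.2
  -- Since `(ad u) ^ l` acts on the cycles by the charges, `u` has to be multiplied by some `α`
  -- with `α ^ l = c⁻¹`.
  obtain ⟨α, hα⟩ : ∃ α : Fˣ, α ^ l * c = 1 := by
    obtain ⟨a, ha⟩ := IsAlgClosed.exists_pow_nat_eq ((c⁻¹ : Fˣ) : F) hl0
    have ha0 : a ≠ 0 := by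
      rintro rfl
      rw [zero_pow hl0.ne'] at ha
      exact (c⁻¹).ne_zero ha.symm
    refine ⟨Units.mk0 a ha0, ?_⟩
    rw [← eq_inv_iff_mul_eq_one]
    exact Units.ext (by simpa using ha)
  -- The coefficients have to grow by the factor `ξ j` along the cycles of the block `j`.
  let ξ : J → Fˣ := fun j => α * stepScalar d (g.1 (j, 1, 0)) / d j
  have hξ : ∀ j, ξ j ^ l = 1 := by
    intro j
    simp only [ξ]
    have h1 : charge d ((j, 1, 0) : CycleLabel J l) = d j ^ l := by simp [charge]
    rw [div_pow, mul_pow, stepScalar_pow hl, hc, ← mul_assoc, hα, one_mul, h1, div_self']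
  have hΩ : ∀ j, ∃ Ω : ZMod l → Fˣ, Ω 0 = 1 ∧ ∀ a, Ω (a + 1) = Ω a * ξ j := by
    intro j
    refine exists_zmod_coboundary (fun _ => ξ j) ?_
    rw [Finset.prod_const, Finset.card_univ, ZMod.card, hξ]
  choose Ω _ hΩ using hΩ
  -- On the cycle of sign `-1` the coefficients are inverse to those of sign `1`, up to a constant
  -- that makes the automorphism fix `z`.
  let ω : CycleLabel J l → Fˣ := fun x =>
    if x.2.1 = 1 then Ω x.1 x.2.2
    else (Ω x.1 x.2.2)⁻¹ * (χ x.1 / stepScalar χ (g.1 (x.1, 1, 0)))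
  have hstepg : ∀ (e : J → Fˣ) (j : J) (σ : ℤˣ) (a : ZMod l),
      stepScalar e (g.1 (j, σ, a)) = signUnit F σ * stepScalar e (g.1 (j, 1, 0)) := by
    intro e j σ a
    rw [autGroup_apply]
    simp only [stepScalar, map_mul]
    rw [mul_comm (signUnit F (g.1 (j, 1, 0)).2.1), mul_assoc]
  have hω1 : ∀ x, stepScalar d x * ω (rotate x) = α * stepScalar d (g.1 x) * ω x := by
    rintro ⟨j, σ, a⟩
    have h1 : d j * ξ j = α * stepScalar d (g.1 (j, 1, 0)) := mul_div_cancel _ _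
    rw [hstepg, rotate_apply, mul_left_comm α, ← h1]
    simp only [stepScalar]
    rcases Int.units_eq_one_or σ with rfl | rfl
    · have h2 := hΩ j a
      simp only [ω, if_true, Units.val_one, Int.cast_one, map_one, one_mul, h2]
      rw [mul_assoc, mul_comm (ξ j)]
    · have h2 := hΩ j (a - 1)
      rw [sub_add_cancel] at h2
      have h3 : (-1 : ℤˣ) ≠ 1 := by decide
      simp only [ω, if_neg h3, Units.val_neg, Units.val_one, Int.cast_neg, Int.cast_one,
        ← sub_eq_add_neg, h2, mul_inv]
      rw [mul_assoc, mul_assoc, mul_assoc]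
      congr 2
      rw [← mul_assoc (ξ j), ← mul_assoc (ξ j), mul_inv_cancel_comm]
  have hω2 : ∀ x, ω x * ω (swap x) * stepScalar χ (g.1 x) = stepScalar χ x := by
    have h3 : (-1 : ℤˣ) ≠ 1 := by decide
    rintro ⟨j, σ, a⟩
    rw [hstepg, swap_apply]
    rcases Int.units_eq_one_or σ with rfl | rfl
    · simp only [ω, if_true, if_neg h3]
      rw [mul_inv_cancel_left, map_one, one_mul, div_mul_cancel]
      simp [stepScalar]
    · simp only [ω, neg_neg, if_true, if_neg h3]
      rw [mul_right_comm _ _ (Ω j a), inv_mul_cancel, one_mul, mul_left_comm, div_mul_cancel]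
      rfl
  let E : Equiv.Perm (Bool ⊕ CycleLabel J l) := (Equiv.sumCongr (Equiv.refl Bool) g.1).symm
  let W : Bool ⊕ CycleLabel J l → Fˣ := Sum.elim (fun t => if t then α else 1) ω
  let f : L ≃ₗ[F] L := b.equiv ((b.reindex E).unitsSMul W) (Equiv.refl _)
  have hfz : f (b (Sum.inl false)) = b (Sum.inl false) := by
    simp [f, E, W, Module.Basis.unitsSMul_apply]
  have hfu : f (b (Sum.inl true)) = (α : F) • b (Sum.inl true) := by
    simp [f, E, W, Module.Basis.unitsSMul_apply, Units.smul_def]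
  have hfv : ∀ x, f (b (Sum.inr x)) = (ω x : F) • b (Sum.inr (g.1 x)) := by
    intro x
    simp [f, E, W, Module.Basis.unitsSMul_apply, Units.smul_def]
  have huv : ∀ x, f ⁅b (Sum.inl true), b (Sum.inr x)⁆
      = ⁅f (b (Sum.inl true)), f (b (Sum.inr x))⁆ := by
    intro x
    rw [hb.u_lie, map_smul, hfv, hfu, hfv, smul_lie, lie_smul, hb.u_lie, hrot, smul_smul,
      smul_smul, smul_smul, ← Units.val_mul, hω1, Units.val_mul, Units.val_mul]
    congr 1
    ring
  have hskew : ∀ {x y : L}, f ⁅x, y⁆ = ⁅f x, f y⁆ → f ⁅y, x⁆ = ⁅f y, f x⁆ := by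
    intro x y h
    rw [← lie_skew, map_neg, h, lie_skew]
  refine ⟨f, mem_lieAut_of_basis b fun i i' => ?_, ⟨α, hfu⟩, ⟨1, by simpa using hfz⟩,
    fun x => ⟨ω x, hfv x⟩⟩
  rcases i with (_ | _) | x
  · rw [hfz, hb.z_lie, hb.z_lie, map_zero]
  · rcases i' with (_ | _) | y
    · rw [hfz, hb.lie_z, hb.lie_z, map_zero]
    · simp
    · exact huv y
  · rcases i' with (_ | _) | y
    · rw [hfz, hb.lie_z, hb.lie_z, map_zero]
    · exact hskew (huv x)
    · by_cases h : y = swap x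
      · rw [h, hb.lie_swap, map_smul, hfz, hfv, hfv, smul_lie, lie_smul, hswap, hb.lie_swap,
          smul_smul, smul_smul, ← hω2 x]
        simp [mul_assoc]
      · have h1 : g.1 y ≠ swap (g.1 x) := by
          rw [← hswap]
          exact fun h2 => h (g.1.injective h2)
        rw [hb.lie_of_ne x y h, map_zero, hfv, hfv, smul_lie, lie_smul, hb.lie_of_ne _ _ h1,
          smul_zero, smul_zero]

end IsCycleBasis

end CycleBasis

/-! ### The Weyl group as a permutation group -/

section WeylGroupEquiv

open CycleLabel

variable {F L J G : Type*} [Field F] [LieRing L] [LieAlgebra F L] {l : ℕ}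

theorem map_span_singleton_eq_iff (f : L ≃ₗ[F] L) (x y : L) :
    (Submodule.span F {x}).map f.toLinearMap = Submodule.span F {y} ↔
      ∃ k : Fˣ, f x = (k : F) • y := by
  rw [Submodule.map_span, Set.image_singleton, eq_comm,
    Submodule.span_singleton_eq_span_singleton]
  exact exists_congr fun k => eq_comm

/-- For a grading whose components are spanned by the vectors of a cycle basis, the Weyl group is
the group of the permutations of the points induced by the automorphisms. -/
theorem IsCycleBasis.nonempty_weylGroup_mulEquiv [IsAlgClosed F] [Nonempty (CycleLabel J l)]
    {b : Module.Basis (Bool ⊕ CycleLabel J l) F L} {d χ : J → Fˣ} (hb : IsCycleBasis b d χ)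
    (hl : Odd l) {𝒜 : G → Submodule F L}
    (h𝒜 : homogeneousComponents 𝒜 = Set.range fun c => Submodule.span F {b c}) :
    Nonempty (WeylGroup 𝒜 ≃* autGroup d l) := by
  have hmem : ∀ c, Submodule.span F {b c} ∈ homogeneousComponents 𝒜 := fun c => by
    rw [h𝒜]; exact ⟨c, rfl⟩
  have hlines : ∀ (f : gradingAut 𝒜) c, ∃ c', ∃ k : Fˣ, f.1.1 (b c) = (k : F) • b c' := by
    intro f c
    have h := (f.2 _).mpr (hmem c)
    rw [h𝒜] at h
    obtain ⟨c', h⟩ := h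
    exact ⟨c', (map_span_singleton_eq_iff _ _ _).mp h.symm⟩
  have hex := fun f : gradingAut 𝒜 =>
    hb.exists_autGroup_of_lieAut hl f.1.2 (hlines f) (hlines f⁻¹)
  choose hfu hfz Φ hΦ using hex
  have huniq : ∀ (f : gradingAut 𝒜) (g : autGroup d l),
      (∀ x, ∃ k : Fˣ, f.1.1 (b (Sum.inr x)) = (k : F) • b (Sum.inr (g.1 x))) → Φ f = g := by
    intro f g h
    refine Subtype.ext (Equiv.ext fun x => ?_)
    obtain ⟨k, hk⟩ := h x
    obtain ⟨k', hk'⟩ := hΦ f x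
    exact Sum.inr_injective
      (basis_index_eq_of_smul_eq_smul b (Units.ne_zero k') (hk'.symm.trans hk))
  let Ψ : gradingAut 𝒜 →* autGroup d l := MonoidHom.mk' Φ (by
    intro f f'
    refine huniq _ _ fun x => ?_
    obtain ⟨k, hk⟩ := hΦ f' x
    obtain ⟨k', hk'⟩ := hΦ f ((Φ f').1 x)
    refine ⟨k * k', ?_⟩
    change f.1.1 (f'.1.1 _) = _
    rw [hk, map_smul, hk', smul_smul, Units.val_mul]
    rfl)
  have hker : Ψ.ker = gradingStab 𝒜 := by
    ext f
    rw [MonoidHom.mem_ker]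
    constructor
    · intro h a
      have h' : Φ f = 1 := h
      by_cases h0 : 𝒜 a = ⊥
      · rw [h0, Submodule.map_bot]
      · have h1 : 𝒜 a ∈ homogeneousComponents 𝒜 := ⟨h0, a, rfl⟩
        rw [h𝒜] at h1
        obtain ⟨c, hc⟩ := h1
        rw [← hc]
        refine (map_span_singleton_eq_iff _ _ _).mpr ?_
        rcases c with (_ | _) | x
        · exact hfz f
        · exact hfu f
        · have h2 := hΦ f x
          rwa [h'] at h2
    · intro h
      refine huniq f 1 fun x => ?_
      obtain ⟨-, a, ha⟩ := hmem (Sum.inr x)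
      have h1 := h a
      rw [ha] at h1
      exact (map_span_singleton_eq_iff _ _ _).mp h1
  have hsurj : Function.Surjective Ψ := by
    intro g
    obtain ⟨f, hf, hu, hz, hv⟩ := hb.exists_lieAut_of_autGroup hl g
    have hfb : ∀ c, ∃ k : Fˣ, f (b c) = (k : F) • b (Equiv.sumCongr (Equiv.refl Bool) g.1 c) := by
      rintro ((_ | _) | x)
      · exact hz
      · exact hu
      · exact hv x
    have hmap : ∀ c, (Submodule.span F {b c}).map f.toLinearMap
        = Submodule.span F {b (Equiv.sumCongr (Equiv.refl Bool) g.1 c)} := fun c =>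
      (map_span_singleton_eq_iff _ _ _).mpr (hfb c)
    have hfA : (⟨f, hf⟩ : lieAut F L) ∈ gradingAut 𝒜 := by
      intro U
      change U.map f.toLinearMap ∈ _ ↔ _
      rw [h𝒜]
      constructor
      · rintro ⟨c, hc⟩
        refine ⟨(Equiv.sumCongr (Equiv.refl Bool) g.1).symm c, ?_⟩
        apply Submodule.map_injective_of_injective f.injective
        rw [← hc]
        simp only
        refine (hmap _).trans ?_
        rw [Equiv.apply_symm_apply]
      · rintro ⟨c, rfl⟩
        exact ⟨_, (hmap c).symm⟩
    exact ⟨⟨⟨f, hf⟩, hfA⟩, huniq _ _ hv⟩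
  exact ⟨(QuotientGroup.quotientMulEquivOfEq hker.symm).trans
    (QuotientGroup.quotientKerEquivOfSurjective Ψ hsurj)⟩

end WeylGroupEquiv

/-! ### Renormalization of the basis of a grading `Γ(l, s, 0; β₁, …, β_s)` -/

section GammaGrading

open CycleLabel

/-- The indices of a block as residues: the index `i : Fin l`, that of the `(i + 1)`-st elements
of a block, corresponds to the residue of `i + 1`. -/
theorem exists_zmod_equiv_fin {l : ℕ} (hl : 0 < l) : ∃ idx : ZMod l ≃ Fin l,
    (∀ a, idx (a + 1) = finRotate l (idx a)) ∧ ∀ a, (idx a : ℕ) + 1 = l ↔ a = 0 := by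
  have key : ∀ n : ℕ, ∃ idx : Fin (n + 1) ≃ Fin (n + 1),
      (∀ a, idx (a + 1) = finRotate (n + 1) (idx a)) ∧ ∀ a, (idx a : ℕ) + 1 = n + 1 ↔ a = 0 := by
    refine fun n => ⟨Equiv.subRight 1, fun a => ?_, fun a => ?_⟩
    · rw [finRotate_apply, Equiv.subRight_apply, Equiv.subRight_apply, add_sub_cancel_right,
        sub_add_cancel]
    · have h : ((a - 1 : Fin (n + 1)) : ℕ) = n ↔ a - 1 = Fin.last n := by
        rw [Fin.ext_iff, Fin.val_last]
      rw [Equiv.subRight_apply, add_left_inj, h, sub_eq_iff_eq_add, Fin.last_add_one]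
  obtain ⟨n, rfl⟩ : ∃ n, l = n + 1 := ⟨l - 1, by omega⟩
  exact key n

/-- The label `x j i` or `y j i`, according to the sign. -/
def signedLabel {s l : ℕ} (j : Fin s) (σ : ℤˣ) (i : Fin l) : BlockLabel s l :=
  if σ = 1 then .x j i else .y j i

theorem signedLabel_one {s l : ℕ} (j : Fin s) (i : Fin l) : signedLabel j 1 i = .x j i := rfl

theorem signedLabel_neg_one {s l : ℕ} (j : Fin s) (i : Fin l) : signedLabel j (-1) i = .y j i :=
  if_neg (by decide)

/-- The labels of a grading `Γ(l, s, 0; β₁, …, β_s)` and those of a cycle basis: the blocks are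
matched by `e`, and `η_j` tells whether the cycle of sign `1` of the block `j` consists of the
vectors `x_i` or of the vectors `y_i`. -/
def blockLabelEquiv {J : Type*} {s l : ℕ} (e : J ≃ Fin s) (η : J → ℤˣ) (idx : ZMod l ≃ Fin l) :
    Bool ⊕ CycleLabel J l ≃ BlockLabel s l where
  toFun := Sum.elim (fun t => if t then .u else .z)
    fun x => signedLabel (e x.1) (η x.1 * x.2.1) (idx (((x.2.1 : ℤ) : ZMod l) * x.2.2))
  invFun c := match c with
    | .z => Sum.inl false
    | .u => Sum.inl true
    | .x j i => Sum.inr (e.symm j, η (e.symm j),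
        ((η (e.symm j) : ℤ) : ZMod l) * idx.symm i)
    | .y j i => Sum.inr (e.symm j, -η (e.symm j),
        ((-η (e.symm j) : ℤˣ) : ℤ) * idx.symm i)
  left_inv := by
    rintro ((_ | _) | ⟨j, σ, a⟩)
    · rfl
    · rfl
    · simp only [Sum.elim_inr]
      have h : η j * σ = 1 ∨ η j * σ = -1 := Int.units_eq_one_or _
      rcases h with h | h
      · have h1 : σ = η j := by
          rw [← mul_one (η j), ← h, ← mul_assoc, Int.units_mul_self, one_mul]
        rw [h, signedLabel_one]
        simp only [Equiv.symm_apply_apply, ← h1, ← mul_assoc, units_int_sq_zmod, one_mul]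
      · have h1 : σ = -η j := by
          rw [← mul_neg_one (η j), ← h, ← mul_assoc, Int.units_mul_self, one_mul]
        rw [h, signedLabel_neg_one]
        simp only [Equiv.symm_apply_apply, ← h1, ← mul_assoc, units_int_sq_zmod, one_mul]
  right_inv := by
    rintro (_ | _ | ⟨j, i⟩ | ⟨j, i⟩)
    · rfl
    · rfl
    · simp only [Sum.elim_inr]
      rw [Int.units_mul_self, signedLabel_one, ← mul_assoc, units_int_sq_zmod, one_mul]
      simp
    · simp only [Sum.elim_inr]
      rw [mul_neg, Int.units_mul_self, signedLabel_neg_one, ← mul_assoc, units_int_sq_zmod,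
        one_mul]
      simp

theorem exists_equiv_of_map_univ_eq {A B C : Type*} [Fintype A] [Fintype B] {f : A → C}
    {g : B → C} (h : (Finset.univ : Finset A).val.map f = (Finset.univ : Finset B).val.map g) :
    ∃ e : A ≃ B, ∀ a, g (e a) = f a := by
  classical
  have hc : ∀ c, Nonempty ({a // f a = c} ≃ {b // g b = c}) := by
    intro c
    have h1 := congrArg (Multiset.count c) h
    rw [Multiset.count_map, Multiset.count_map] at h1
    refine ⟨Fintype.equivOfCardEq ?_⟩
    rw [Fintype.card_subtype, Fintype.card_subtype]
    simp only [eq_comm (b := c)]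
    exact h1
  exact ⟨Equiv.ofFiberEquiv fun c => (hc c).some, fun a => Equiv.ofFiberEquiv_map _ a⟩

variable {F L J G : Type*} [Field F] [LieRing L] [LieAlgebra F L] {l s : ℕ}

/-- A grading `Γ(l, s, 0; β₁, …, β_s)` has a cycle basis with any representatives `d_j` of the
classes of the `β_j`. As `β_j ^ l = ±d_j ^ l` and `l` is odd, rescaling the vectors of a block turns
the scalars of `ad u` along its two cycles into the constants `d_j` and `-d_j`. The indices run
along the cycle of sign `-1` in the opposite direction, so that the vectors with nonzero bracket
get the same residue. -/
theorem exists_isCycleBasis (hl : Odd l) {β : Fin s → Fˣ} {𝒜 : G → Submodule F L}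
    (hΓ : IsGammaGrading 𝒜 l s β) (d : J → Fˣ) (e : J ≃ Fin s)
    (he : ∀ j, tildeClass l (β (e j)) = tildeClass l (d j)) :
    ∃ (b : Module.Basis (Bool ⊕ CycleLabel J l) F L) (χ : J → Fˣ), IsCycleBasis b d χ ∧
      homogeneousComponents 𝒜 = Set.range fun c => Submodule.span F {b c} := by
  obtain ⟨b, hz, hblock, hne, h𝒜⟩ := hΓ
  have : NeZero l := ⟨hl.pos.ne'⟩
  obtain ⟨idx, hidx, hidx0⟩ := exists_zmod_equiv_fin hl.pos
  have hη : ∀ j, ∃ η : ℤˣ, β (e j) ^ l = signUnit F η * d j ^ l := by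
    intro j
    have h2 := tildeClass_eq_iff.mp (he j)
    rw [mul_comm 2 l, pow_mul, pow_mul] at h2
    obtain ⟨η, hη⟩ := exists_signUnit_of_sq_eq_one (a := β (e j) ^ l / d j ^ l)
      (by rw [div_pow, h2, div_self'])
    exact ⟨η, by rw [← hη, div_mul_cancel]⟩
  choose η hη using hη
  let w : Fin s → ℤˣ → ZMod l → L := fun j σ a => b (signedLabel j σ (idx a))
  -- The sign of the step from `a` to `a + 1`: it is nontrivial only from `y_l` to `y_1`, and the
  -- vectors with index `l` have the residue `0`.
  let C : ℤˣ → ZMod l → Fˣ := fun σ a => if a = 0 then signUnit F σ else 1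
  have hzl : ∀ a : L, ⁅a, b .z⁆ = 0 := fun a => by rw [← lie_skew, hz, neg_zero]
  have huw : ∀ j σ a, ⁅b .u, w j σ a⁆ = ((C σ a * β j : Fˣ) : F) • w j σ (a + 1) := by
    intro j σ a
    rcases Int.units_eq_one_or σ with rfl | rfl
    · simp only [w, signedLabel_one, C, map_one, ite_self, one_mul, hidx]
      exact (hblock j).u_x (idx a)
    · simp only [w, signedLabel_neg_one, C, hidx]
      rw [(hblock j).u_y (idx a)]
      by_cases h : a = 0
      · rw [if_pos ((hidx0 a).mpr h), if_pos h, hl.neg_one_pow, signUnit_neg, map_one]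
        simp
      · rw [if_neg (fun h' => h ((hidx0 a).mp h')), if_neg h]
        simp
  have hww : ∀ j j' σ σ' a a', j ≠ j' ∨ σ = σ' → ⁅w j σ a, w j' σ' a'⁆ = 0 := by
    intro j j' σ σ' a a' h
    by_cases hj : j = j'
    · subst hj
      obtain rfl : σ = σ' := h.resolve_left (fun h => h rfl)
      rcases Int.units_eq_one_or σ with rfl | rfl
      · exact (hblock j).x_x _ _
      · simp only [w, signedLabel_neg_one]
        exact (hblock j).y_y _ _
    · have h1 := hne j j' hj
      rcases Int.units_eq_one_or σ with rfl | rfl <;> rcases Int.units_eq_one_or σ' with rfl | rfl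
      · exact (h1 _ _).1
      · simp only [w, signedLabel_one, signedLabel_neg_one]
        exact (h1 _ _).2.1
      · simp only [w, signedLabel_one, signedLabel_neg_one]
        rw [← lie_skew, (hne j' j (Ne.symm hj) _ _).2.1, neg_zero]
      · simp only [w, signedLabel_neg_one]
        exact (h1 _ _).2.2
  have hwz : ∀ j σ a a', ∃ t : F, ⁅w j σ a, w j (-σ) a'⁆ = t • b .z := by
    intro j σ a a'
    rcases Int.units_eq_one_or σ with rfl | rfl
    · simp only [w, signedLabel_one, signedLabel_neg_one]
      exact ⟨_, (hblock j).x_y _ _⟩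
    · simp only [w, neg_neg, signedLabel_one, signedLabel_neg_one]
      rw [← lie_skew]
      exact ⟨_, by rw [(hblock j).x_y, ← neg_smul]⟩
  have hxy : ∀ j a a', a = 0 ∨ a' = 0 → ⁅w j 1 a, w j (-1) a'⁆
      = (if a = a' then -(β j : F) else 0) • b .z := by
    intro j a a' h
    simp only [w, signedLabel_one, signedLabel_neg_one]
    rw [(hblock j).x_y]
    have ha := (idx a).2
    have ha' := (idx a').2
    congr 1
    by_cases h1 : a = a'
    · subst h1
      have h2 := (hidx0 a).mpr (by simpa using h)
      rw [if_pos rfl, if_pos (Or.inr (by omega)), h2, hl.neg_one_pow, neg_one_mul]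
    · rw [if_neg h1, if_neg]
      intro h3
      rcases h with h | h
      · have h4 := (hidx0 a).mpr h
        exact h1 (h.trans ((hidx0 a').mp (by omega)).symm)
      · have h4 := (hidx0 a').mpr h
        exact h1 (((hidx0 a).mp (by omega)).trans h.symm)
  have hω : ∀ j σ, ∃ ω : ZMod l → Fˣ, ω 0 = 1 ∧
      ∀ a, ω (a + 1) = ω a * (C (η j * σ) a * β (e j) / (signUnit F σ * d j)) := by
    intro j σ
    apply exists_zmod_coboundary
    have h1 : ∏ a : ZMod l, C (η j * σ) a = signUnit F (η j * σ) := by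
      simp only [C]
      rw [Finset.prod_ite_eq' Finset.univ (0 : ZMod l)]
      simp
    rw [Finset.prod_div_distrib, Finset.prod_mul_distrib, h1, Finset.prod_const,
      Finset.prod_const, Finset.card_univ, ZMod.card, hη, mul_pow, signUnit_pow_odd _ hl, map_mul]
    rw [mul_right_comm, ← mul_assoc, ← map_mul, Int.units_mul_self, map_one, one_mul, mul_comm,
      div_self']
  choose ω hω0 hω using hω
  let W : Bool ⊕ CycleLabel J l → Fˣ := Sum.elim (fun _ => 1)
    fun x => ω x.1 x.2.1 (((x.2.1 : ℤ) : ZMod l) * x.2.2)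
  let E := blockLabelEquiv e η idx
  let b' := (b.reindex E.symm).unitsSMul W
  have hb' : ∀ c, b' c = (W c : F) • b (E c) := by
    intro c
    simp [b', Module.Basis.unitsSMul_apply, Units.smul_def]
  have hb'z : b' (Sum.inl false) = b .z := by
    rw [hb']
    simp [W, E, blockLabelEquiv]
  have hb'u : b' (Sum.inl true) = b .u := by
    rw [hb']
    simp [W, E, blockLabelEquiv]
  have hb'v : ∀ j σ a, b' (Sum.inr (j, σ, a)) = (ω j σ (((σ : ℤ) : ZMod l) * a) : F) •
      w (e j) (η j * σ) (((σ : ℤ) : ZMod l) * a) := fun j σ a => hb' _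
  have hstep : ∀ x, ⁅b' (Sum.inl true), b' (Sum.inr x)⁆
      = (stepScalar d x : F) • b' (Sum.inr (rotate x)) := by
    rintro ⟨j, σ, a⟩
    rw [hb'u, rotate_apply, hb'v, hb'v, lie_smul, huw, mul_add, units_int_sq_zmod, smul_smul,
      smul_smul, hω]
    congr 1
    rw [← Units.val_mul, ← Units.val_mul]
    congr 1
    simp only [stepScalar]
    rw [mul_comm (signUnit F σ * d j), mul_assoc, div_mul_cancel]
  have hd0 : ∀ j, (d j : F) ≠ 0 := fun j => (d j).ne_zero
  -- By the Jacobi identity, the brackets of opposite cycles are invariant under rotations.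
  have hrot : ∀ j (a a' : ZMod l), ⁅b' (Sum.inr (j, 1, a + 1)), b' (Sum.inr (j, -1, a' + 1))⁆
      = ⁅b' (Sum.inr (j, 1, a)), b' (Sum.inr (j, -1, a'))⁆ := by
    intro j a a'
    have h1 := leibniz_lie (b' (Sum.inl true)) (b' (Sum.inr (j, 1, a)))
      (b' (Sum.inr (j, -1, a' + 1)))
    have h0 : ⁅b' (Sum.inl true), ⁅b' (Sum.inr (j, 1, a)), b' (Sum.inr (j, -1, a' + 1))⁆⁆ = 0 := by
      obtain ⟨t, ht⟩ := hwz (e j) (η j * 1) (((1 : ℤˣ) : ℤ) * a)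
        ((((-1 : ℤˣ) : ℤ) : ZMod l) * (a' + 1))
      rw [hb'v, hb'v, smul_lie, lie_smul, show η j * -1 = -(η j * 1) by simp, lie_smul, lie_smul,
        ht, lie_smul, hzl]
      simp
    rw [h0, hstep, hstep, rotate_apply, rotate_apply] at h1
    simp only [stepScalar, signUnit_neg, map_one, Units.val_one, Int.cast_one, one_mul,
      Units.val_neg, Int.cast_neg, ← sub_eq_add_neg, add_sub_cancel_right, smul_lie, lie_smul,
      neg_mul, neg_smul, lie_neg] at h1
    rw [eq_comm, sub_eq_zero] at h1
    exact smul_right_injective L (hd0 j) h1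
  have hv0 : ∀ j (a' : ZMod l), ⁅b' (Sum.inr (j, 1, 0)), b' (Sum.inr (j, -1, a'))⁆
      = (if a' = 0 then ((-(signUnit F (η j)) * β (e j) : Fˣ) : F) else 0) • b .z := by
    intro j a'
    rw [hb'v, hb'v, mul_zero, hω0, Units.val_one, one_smul, lie_smul, mul_one]
    simp only [Units.val_neg, Units.val_one, Int.cast_neg, Int.cast_one, neg_mul, one_mul, mul_neg,
      mul_one]
    rcases Int.units_eq_one_or (η j) with h | h
    · rw [h, hxy _ _ _ (Or.inl rfl)]
      by_cases ha : a' = 0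
      · simp [ha, hω0]
      · simp [ha]
    · rw [h, neg_neg, ← lie_skew, hxy _ _ _ (Or.inr rfl)]
      by_cases ha : a' = 0
      · simp [ha, hω0, signUnit_neg]
      · simp [ha]
  have hpair : ∀ j (a a' : ZMod l), ⁅b' (Sum.inr (j, 1, a)), b' (Sum.inr (j, -1, a'))⁆
      = (if a' = a then ((-(signUnit F (η j)) * β (e j) : Fˣ) : F) else 0) • b .z := by
    intro j a a'
    have h1 : ∀ n : ℕ, ⁅b' (Sum.inr (j, 1, (n : ZMod l))), b' (Sum.inr (j, -1, a' - a + n))⁆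
        = ⁅b' (Sum.inr (j, 1, 0)), b' (Sum.inr (j, -1, a' - a))⁆ := by
      intro n
      induction n with
      | zero => simp
      | succ n ih =>
        rw [Nat.cast_succ, ← add_assoc, hrot, ih]
    have h2 := h1 a.val
    rw [ZMod.natCast_zmod_val, sub_add_cancel, hv0] at h2
    rw [h2]
    simp only [sub_eq_zero]
  refine ⟨b', fun j => -(signUnit F (η j)) * β (e j), ⟨fun a => ?_, hstep, ?_, ?_⟩, ?_⟩
  · rw [hb'z, hz]
  · rintro ⟨j, σ, a⟩
    rw [swap_apply, hb'z]
    rcases Int.units_eq_one_or σ with rfl | rfl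
    · rw [hpair, if_pos rfl]
      simp [stepScalar]
    · rw [neg_neg, ← lie_skew, hpair, if_pos rfl, ← neg_smul]
      simp [stepScalar, signUnit_neg]
  · rintro ⟨j, σ, a⟩ ⟨j', σ', a'⟩ h
    by_cases hj : j ≠ j' ∨ σ = σ'
    · rw [hb'v, hb'v, smul_lie, lie_smul, hww, smul_zero, smul_zero]
      rcases hj with hj | rfl
      · exact Or.inl fun h' => hj (e.injective h')
      · by_cases hj : j = j'
        · exact Or.inr (by rw [hj])
        · exact Or.inl fun h' => hj (e.injective h')
    · rw [not_or, not_not] at hj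
      obtain ⟨rfl, hσ⟩ := hj
      obtain rfl : σ' = -σ := by
        rw [← neg_eq_iff_eq_neg]
        exact (Int.units_ne_iff_eq_neg.mp hσ).symm
      have ha : a' ≠ a := by
        rintro rfl
        exact h rfl
      rcases Int.units_eq_one_or σ with rfl | rfl
      · rw [hpair, if_neg ha, zero_smul]
      · rw [neg_neg, ← lie_skew, hpair, if_neg (Ne.symm ha), zero_smul, neg_zero]
  · have h1 : (fun c => Submodule.span F {b' c}) = (fun c => Submodule.span F {b c}) ∘ E := by
      funext c
      rw [hb']
      exact Submodule.span_singleton_smul_eq (Units.isUnit _) _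
    rw [h1, E.surjective.range_comp, h𝒜]

end GammaGrading

/-! ### The Weyl group of the grading `Γ(l, s, 0; β₁, …, β_s)` -/

theorem TwistedHeisenberg.finrank_eq {F : Type*} [Field F] {k : ℕ} (lam : Fin k → Fˣ) :
    Module.finrank F (TwistedHeisenberg lam) = 2 * k + 2 := by
  have e : TwistedHeisenberg lam ≃ₗ[F] F × F × (Fin k → F) × (Fin k → F) :=
    Equiv.linearEquiv F TwistedHeisenberg.toProd
  rw [e.finrank_eq]
  simp
  ring

theorem mainTheorem10 {F : Type*} [Field F] [IsAlgClosed F] [CharZero F]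
    {k n : ℕ} (hk : 0 < k) (hn : n = 2 * k + 2) (lam : Fin k → Fˣ)
    {G : Type*} [AddCommGroup G] [DecidableEq G]
    (𝒜 : G → Submodule F (TwistedHeisenberg lam)) [GradedLieAlgebra 𝒜]
    (l s : ℕ) (hl : Odd l) (β : Fin s → Fˣ) (hΓ : IsGammaGrading 𝒜 l s β)
    {s' : ℕ} (m : Fin s' → ℕ) (hm : ∀ i, 0 < m i) (δ : Fin s' → Fˣ)
    (hδ : Function.Injective fun i => tildeClass l (δ i))
    (hβ : (Finset.univ.val.map fun j => tildeClass l (β j))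
      = ∑ i, Multiset.replicate (m i) (tildeClass l (δ i))) :
    ∑ i, m i = s ∧ (s : ℚ) = ((n : ℚ) - 2) / (2 * (l : ℚ)) ∧
    ∃ p q : ℕ, IsGreatest (splittingOrders l β) p ∧ q ∣ p ∧
      ∀ ε : Fˣ, IsPrimitiveRoot ε p →
        IsLeast {a : ℕ | 0 < a ∧ tildeClass l ε ^ a = tildeClass l 1} q ∧
        ∃ (φ : Multiplicative (ZMod p) →* MulAut (BlockWeylGroup l m))
          (π : Equiv.Perm (Σ i, Fin (m i))) (τ : (Σ i, Fin (m i)) → ℤˣ)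
          (w : BlockWeylGroup l m)
          (K : Subgroup (BlockWeylGroup l m ⋊[φ] Multiplicative (ZMod p))) (_ : K.Normal),
          (∀ j, tildeClass l (ε * δ j.1) = tildeClass l (δ (π j).1)) ∧
          IsInducedByBlockPerm (φ (Multiplicative.ofAdd 1)) π τ ∧
          K = Subgroup.zpowers
            (SemidirectProduct.inr (Multiplicative.ofAdd 1) ^ q * (SemidirectProduct.inl w)⁻¹) ∧
          Nonempty (K ≃* Multiplicative (ZMod (p / q))) ∧
          Nonempty (WeylGroup 𝒜 ≃*
            (BlockWeylGroup l m ⋊[φ] Multiplicative (ZMod p)) ⧸ K) := by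
  have hl0 : 0 < l := hl.pos
  have : NeZero l := ⟨hl0.ne'⟩
  have hM := map_univ_sigma_fst m fun i => tildeClass l (δ i)
  have hβM := hβ.trans hM.symm
  obtain ⟨e, he⟩ := exists_equiv_of_map_univ_eq hβM.symm
  have hsum : ∑ i, m i = s := by
    have h := Fintype.card_congr e
    simpa using h
  obtain ⟨b, χ, hb, h𝒜⟩ := exists_isCycleBasis hl hΓ (fun j => δ j.1) e he
  have hdim : s * l = k := by
    have h1 := Module.finrank_eq_card_basis b
    rw [TwistedHeisenberg.finrank_eq, Fintype.card_sum, Fintype.card_prod, Fintype.card_prod,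
      Fintype.card_congr e, ZMod.card, Fintype.card_fin, Fintype.card_bool,
      Fintype.card_units_int] at h1
    nlinarith
  have hs0 : 0 < s := Nat.pos_of_ne_zero (by rintro rfl; omega)
  have hJ : Nonempty (Σ i, Fin (m i)) := ⟨e.symm ⟨0, hs0⟩⟩
  refine ⟨hsum, ?_, ?_⟩
  · have hlQ : (l : ℚ) ≠ 0 := by exact_mod_cast hl0.ne'
    rw [hn, ← hdim]
    push_cast
    field_simp
    ring
  have hM0 : (Finset.univ.val.map fun j => tildeClass l (β j)) ≠ 0 := by
    rw [ne_eq, Multiset.map_eq_zero, Finset.val_eq_zero]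
    exact (Finset.univ_nonempty_iff.mpr ⟨⟨0, hs0⟩⟩).ne_empty
  obtain ⟨q, hq, hstab⟩ := exists_mem_multisetStabilizer_tildeClass_iff hl0.ne' hM0
  refine ⟨2 * l * q, q, isGreatest_splittingOrders (by positivity) hstab, Dvd.intro_left _ rfl,
    fun ε hε => ⟨isLeast_tildeClass_pow_eq_one hl0.ne' hq hε, ?_⟩⟩
  rw [hβM] at hstab
  obtain ⟨φ, π, τ, w, K, hK, hπ, hφ, hKeq, hKcard, ⟨hquot⟩⟩ :=
    exists_autGroup_presentation hl hm hδ hq hstab hε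
  obtain ⟨hW⟩ := hb.nonempty_weylGroup_mulEquiv hl h𝒜
  exact ⟨φ, π, τ, w, K, hK, hπ, hφ, hKeq, hKcard, ⟨hW.trans hquot⟩⟩
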